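/- Let $X$ be an oriented smooth 7-manifold with a $G_2$-structure $\varphi$, that is, a smooth 3-form $\varphi \in \Omega^3(X)$ such that at every point $p$ there is a positively oriented basis $e_1,\dots,e_7$ of $T_pX$ with dual basis $e^1,\dots,e^7$ satisfying $$\varphi_p = e^{123}+e^{145}+e^{167}+e^{246}-e^{257}-e^{347}-e^{356}, \qquad e^{i_1\cdots i_k} = e^{i_1}\wedge\cdots\wedge e^{i_k}.$$ (Neither compactness of $X$ nor closedness of $\varphi$ is assumed.) Let $g_\varphi$ be the Riemannian metric determined by $\varphi$, for which all such bases are orthonormal; equivalently $g_\varphi(u,v)\,\mathrm{vol} = \frac16\, i(u)\varphi\wedge i(v)\varphi\wedge\varphi$ with $\mathrm{vol}=e^{1\cdots 7}$. Let $*$ be the Hodge star, $\langle\cdot,\cdot\rangle$ the inner product and $|\cdot|$ the norm on forms (extended to complex-valued forms) given by $g_\varphi$ and the orientation; $\sharp$ denotes the isomorphism $T^*X\to TX$ given by $g_\varphi$. Let $L\to X$ be a smooth complex line bundle with a smooth Hermitian metric, let $\nabla$ be any Hermitian connection on $L$, and let $F=F_\nabla$ be its curvature, an $\sqrt{-1}\,\mathbb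 R$-valued 2-form on $X$; write $F^2=F\wedge F$, $F^3=F\wedge F\wedge F$. Let $(-\sqrt{-1}F)^\sharp$ be the endomorphism $u\mapsto(-\sqrt{-1}\,i(u)F)^\sharp$ of $TX$. The connection $\nabla$ is called a $G_2$-dDT (deformed Donaldson–Thomas) connection if $$\tfrac16F^3+F\wedge *\varphi=0 \quad\text{on } X.$$ Then at every point of $X$ $$\Bigl(1+\tfrac12\langle F^2,*\varphi\rangle\Bigr)^2+\Bigl|*\varphi\wedge F+\tfrac16F^3\Bigr|^2+\tfrac14\bigl|\varphi\wedge *F^2\bigr|^2=\det\bigl(\mathrm{id}_{TX}+(-\sqrt{-1}F)^\sharp\bigr).$$ In particular, at every point of $X$ $$\Bigl|1+\tfrac12\langle F^2,*\varphi\rangle\Bigr|\le\sqrt{\det\bigl(\mathrm{id}_{TX}+(-\sqrt{-1}F)^\sharp\bigr)},$$ and equality holds at every point of $X$ if and only if $\nabla$ is a $G_2$-dDT connection. -/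

import Mathlib

open Bundle
open scoped Manifold ContDiff

noncomputable section

namespace G2dDT

/-! ### Exterior algebra on a real vector space -/

lemma append_update {W : Type*} {k l : ℕ} [DecidableEq (Fin l)] (u : Fin k → W) (v : Fin l → W)
    (i : Fin l) (x : W) : Fin.append u (Function.update v i x) =
      Function.update (Fin.append u v) (Fin.natAdd k i) x := by
  ext j
  refine Fin.addCases (fun a => ?_) (fun a => ?_) j
  · rw [Fin.append_left, Function.update_of_ne, Fin.append_left]
    intro h
    have := congrArg Fin.val h
    simp at this
    omega
  · rcases eq_or_ne a i with rfl | h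
    · simp
    · rw [Fin.append_right, Function.update_of_ne h, Function.update_of_ne, Fin.append_right]
      simpa using h

section Forms

variable {V : Type*} [AddCommGroup V] [Module ℝ V]

/-- The wedge product of alternating forms with values in a commutative `ℝ`-algebra `A`
(a sum over shuffles, so that `(e¹ ∧ e²)(e₁, e₂) = 1`). -/
def wedge {A : Type*} [CommRing A] [Algebra ℝ A] {k l : ℕ}
    (α : V [⋀^Fin k]→ₗ[ℝ] A) (β : V [⋀^Fin l]→ₗ[ℝ] A) : V [⋀^Fin (k + l)]→ₗ[ℝ] A :=
  ((LinearMap.mul' ℝ A).compAlternatingMap (α.domCoprod β)).domDomCongr finSumFinEquiv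

/-- A real form, regarded as a complex-valued form. -/
def complexify {k : ℕ} (α : V [⋀^Fin k]→ₗ[ℝ] ℝ) : V [⋀^Fin k]→ₗ[ℝ] ℂ :=
  Complex.ofRealCLM.toLinearMap.compAlternatingMap α

/-- The real part of a complex-valued form. -/
def realPart {k : ℕ} (α : V [⋀^Fin k]→ₗ[ℝ] ℂ) : V [⋀^Fin k]→ₗ[ℝ] ℝ :=
  Complex.reCLM.toLinearMap.compAlternatingMap α

/-- For a basis `e₁, …, eₙ` with dual basis `e¹, …, eⁿ`, the form `e^{i₁} ∧ ⋯ ∧ e^{iₖ}`, that is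
`(v₁, …, vₖ) ↦ det (e^{iₐ}(v_c))`. -/
def coframeWedge {n k : ℕ} (b : Module.Basis (Fin n) ℝ V) (i : Fin k → Fin n) :
    V [⋀^Fin k]→ₗ[ℝ] ℝ :=
  Matrix.detRowAlternating.compLinearMap (LinearMap.pi fun a => b.coord (i a))

/-- The iterated interior product of a form with the vectors `u₁, …, u_k`, that is
`(v₁, …, v_l) ↦ w(u₁, …, u_k, v₁, …, v_l)`. -/
def interiorMul {k l : ℕ} (u : Fin k → V) (w : V [⋀^Fin (k + l)]→ₗ[ℝ] ℝ) :
    V [⋀^Fin l]→ₗ[ℝ] ℝ where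
  toFun v := w (Fin.append u v)
  map_update_add' v i x y := by
    simp only [append_update, AlternatingMap.map_update_add]
  map_update_smul' v i c x := by
    simp only [append_update, AlternatingMap.map_update_smul]
  map_eq_zero_of_eq' v i j h hij := by
    refine w.map_eq_zero_of_eq _ (i := Fin.natAdd k i) (j := Fin.natAdd k j) ?_ ?_
    · simpa using h
    · simpa using hij

/-- The Hodge star operator, extended complex-linearly, of the inner product and the orientation
for which the basis `b` is oriented and orthonormal:
`*α = ∑ α(e_I) vol(e_I, ·)`, the sum over increasing multi-indices `I`, where
`vol = e¹ ∧ ⋯ ∧ eⁿ`. -/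
def hodgeStar {k l : ℕ} (b : Module.Basis (Fin (k + l)) ℝ V) (α : V [⋀^Fin k]→ₗ[ℝ] ℂ) :
    V [⋀^Fin l]→ₗ[ℝ] ℂ :=
  ∑ I : Fin k ↪o Fin (k + l), α (b ∘ I) • complexify (interiorMul (b ∘ I) b.det)

/-- The Hermitian inner product of complex-valued `k`-forms induced by the inner product for which
the basis `b` is orthonormal: `⟨α, β⟩ = ∑ α(e_I) conj(β(e_I))`, the sum over increasing
multi-indices `I`, so that the forms `e^I` are orthonormal. -/
def formInner {n k : ℕ} (b : Module.Basis (Fin n) ℝ V) (α β : V [⋀^Fin k]→ₗ[ℝ] ℂ) : ℂ :=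
  ∑ I : Fin k ↪o Fin n, α (b ∘ I) * starRingEnd ℂ (β (b ∘ I))

/-- The squared norm `|α|²` of a complex-valued form, for the inner product for which the basis `b`
is orthonormal. -/
def formNormSq {n k : ℕ} (b : Module.Basis (Fin n) ℝ V) (α : V [⋀^Fin k]→ₗ[ℝ] ℂ) : ℝ :=
  ∑ I : Fin k ↪o Fin n, ‖α (b ∘ I)‖ ^ 2

/-- For a 2-form `E`, the endomorphism `E^♯ : u ↦ (i(u)E)^♯`, with respect to the inner product
`g` for which the basis `b` is orthonormal: `g(E^♯ u, v) = E(u, v)`. -/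
def sharpEnd {n : ℕ} (b : Module.Basis (Fin n) ℝ V) (E : V [⋀^Fin 2]→ₗ[ℝ] ℝ) : V →ₗ[ℝ] V where
  toFun u := ∑ i, E ![u, b i] • b i
  map_add' u v := by
    have h (i : Fin n) : E ![u + v, b i] = E ![u, b i] + E ![v, b i] := by
      simpa using E.map_vecCons_add ![b i] u v
    simp only [h, add_smul, Finset.sum_add_distrib]
  map_smul' c u := by
    have h (i : Fin n) : E ![c • u, b i] = c • E ![u, b i] := E.map_vecCons_smul ![b i] c u
    simp only [h, smul_assoc, Finset.smul_sum, RingHom.id_apply]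

/-- The 3-form `e¹²³ + e¹⁴⁵ + e¹⁶⁷ + e²⁴⁶ - e²⁵⁷ - e³⁴⁷ - e³⁵⁶` of a basis `e₁, …, e₇`
(the indices are shifted by one below). -/
def modelG2Form (b : Module.Basis (Fin 7) ℝ V) : V [⋀^Fin 3]→ₗ[ℝ] ℝ :=
  coframeWedge b ![0, 1, 2] + coframeWedge b ![0, 3, 4] + coframeWedge b ![0, 5, 6]
    + coframeWedge b ![1, 3, 5] - coframeWedge b ![1, 4, 6] - coframeWedge b ![2, 3, 6]
    - coframeWedge b ![2, 4, 5]

end Forms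

/-! ### Hermitian connections on complex line bundles and their curvature -/

section Connection

open FiberBundle VectorField Filter
open scoped Topology

variable {X : Type*} [TopologicalSpace X] [ChartedSpace (EuclideanSpace ℝ (Fin 7)) X]
  [IsManifold (𝓡 7) ∞ X]

section Extension

variable {M F : Type*} [TopologicalSpace M] [NormedAddCommGroup F] [NormedSpace ℝ F]
  {V : M → Type*} [TopologicalSpace (TotalSpace F V)] [∀ x, AddCommGroup (V x)]
  [∀ x, Module ℝ (V x)] [∀ x, TopologicalSpace (V x)] [FiberBundle F V] [VectorBundle ℝ F V]
  {x : M}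

variable (F) in
/-- The extension of a vector `v` in the fibre over `x` to a section that is constant in the
preferred trivialization at `x` (and zero outside its domain). -/
def localExtend (v : V x) (y : M) : V y :=
  (trivializationAt F V x).symmₗ ℝ y ((trivializationAt F V x).linearMapAt ℝ x v)

lemma localExtend_add (u v : V x) : localExtend F (u + v) = localExtend F u + localExtend F v := by
  funext y
  simp [localExtend]

lemma localExtend_smul (c : ℝ) (v : V x) : localExtend F (c • v) = c • localExtend F v := by
  funext y
  simp [localExtend]

lemma localExtend_eq_extend (v : V x) {y : M} (hy : y ∈ (trivializationAt F V x).baseSet) :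
    localExtend F v y = extend F v y := by
  have hx := mem_baseSet_trivializationAt' (F := F) (E := V) x
  simp only [localExtend, extend, Trivialization.coe_symmₗ _ hy,
    Trivialization.coe_linearMapAt_of_mem _ hx]

@[simp]
lemma localExtend_self (v : V x) : localExtend F v x = v := by
  rw [localExtend_eq_extend _ (mem_baseSet_trivializationAt' x), extend_apply_self]

variable {E H : Type*} [NormedAddCommGroup E] [NormedSpace ℝ E] [TopologicalSpace H]
  (I : ModelWithCorners ℝ E H) [ChartedSpace H M]

lemma contMDiffOn_localExtend [ContMDiffVectorBundle ∞ F V I] (v : V x) :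
    ∃ s ∈ 𝓝 x, ContMDiffOn I (I.prod 𝓘(ℝ, F)) ∞
      (fun y => TotalSpace.mk' F y (localExtend F v y)) s := by
  obtain ⟨s, hs, h⟩ := exists_contMDiffOn_extend (k := ∞) I F v
  refine ⟨s ∩ (trivializationAt F V x).baseSet, inter_mem hs
    ((trivializationAt F V x).open_baseSet.mem_nhds (mem_baseSet_trivializationAt' x)),
    (h.mono Set.inter_subset_left).congr fun y hy => ?_⟩
  rw [localExtend_eq_extend v hy.2]

lemma mdifferentiableAt_localExtend (v : V x) :
    MDifferentiableAt I (I.prod 𝓘(ℝ, F)) (fun y => TotalSpace.mk' F y (localExtend F v y)) x := by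
  refine (mdifferentiableAt_extend I F v).congr_of_eventuallyEq ?_
  filter_upwards [(trivializationAt F V x).open_baseSet.mem_nhds
    (mem_baseSet_trivializationAt' x)] with y hy
  rw [localExtend_eq_extend v hy]

end Extension

variable (L : X → Type*) [∀ x, NormedAddCommGroup (L x)] [∀ x, InnerProductSpace ℂ (L x)]
  [TopologicalSpace (TotalSpace ℂ L)] [FiberBundle ℂ L] [VectorBundle ℝ ℂ L]

/-- A smooth Hermitian connection on a Hermitian complex line bundle `L` over a 7-manifold `X`:
a covariant derivative (`toFun σ x v` is `(∇_v σ)(x)`) that maps smooth sections of `L` to smooth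
`L`-valued 1-forms, is complex-linear, and satisfies
`d⟨σ, τ⟩ = ⟨∇σ, τ⟩ + ⟨σ, ∇τ⟩` for the Hermitian metric `⟨·, ·⟩` of `L`. -/
structure HermitianConnection extends CovariantDerivative (𝓡 7) ℂ L where
  smooth : toCovariantDerivative.ContMDiffCovariantDerivative ∞
  map_I_smul : ∀ (σ : Π x, L x) (x : X) (v : TangentSpace (𝓡 7) x),
    MDifferentiableAt (𝓡 7) ((𝓡 7).prod 𝓘(ℝ, ℂ)) (fun y => TotalSpace.mk' ℂ y (σ y)) x →
    toFun (fun y => Complex.I • σ y) x v = Complex.I • toFun σ x v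
  metric : ∀ (σ τ : Π x, L x) (x : X) (v : TangentSpace (𝓡 7) x),
    MDifferentiableAt (𝓡 7) ((𝓡 7).prod 𝓘(ℝ, ℂ)) (fun y => TotalSpace.mk' ℂ y (σ y)) x →
    MDifferentiableAt (𝓡 7) ((𝓡 7).prod 𝓘(ℝ, ℂ)) (fun y => TotalSpace.mk' ℂ y (τ y)) x →
    mvfderiv (𝓡 7) (fun y => inner ℂ (σ y) (τ y)) x v =
      inner ℂ (toFun σ x v) (τ x) + inner ℂ (σ x) (toFun τ x v)

variable {L}

namespace HermitianConnection

/-- `∇_U ∇_V σ - ∇_V ∇_U σ - ∇_{[U, V]} σ` at the point `p`. -/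
def curvatureOperator (D : HermitianConnection L) (U V : Π x : X, TangentSpace (𝓡 7) x)
    (σ : Π x, L x) (p : X) : L p :=
  D.toFun (fun x => D.toFun σ x (V x)) p (U p) - D.toFun (fun x => D.toFun σ x (U x)) p (V p)
    - D.toFun σ p (mlieBracket (𝓡 7) U V p)

/-- The covariant derivative of a section that is smooth near `p` is differentiable at `p`. -/
lemma mdifferentiableAt_apply [T2Space X] [ContMDiffVectorBundle ∞ ℂ L (𝓡 7)]
    (D : HermitianConnection L) {p : X}
    {σ : Π x, L x} {s : Set X} (hs : s ∈ 𝓝 p)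
    (hσ : ContMDiffOn (𝓡 7) ((𝓡 7).prod 𝓘(ℝ, ℂ)) ∞ (fun y => TotalSpace.mk' ℂ y (σ y)) s)
    {V : Π x : X, TangentSpace (𝓡 7) x}
    (hV : MDifferentiableAt (𝓡 7) ((𝓡 7).prod 𝓘(ℝ, EuclideanSpace ℝ (Fin 7)))
      (fun y => TotalSpace.mk' (EuclideanSpace ℝ (Fin 7)) y (V y)) p) :
    MDifferentiableAt (𝓡 7) ((𝓡 7).prod 𝓘(ℝ, ℂ))
      (fun y => TotalSpace.mk' ℂ y (D.toFun σ y (V y))) p := by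
  obtain ⟨t, hts, ht, hpt⟩ := mem_nhds_iff.1 hs
  obtain ⟨f, -, hf⟩ := (SmoothBumpFunction.nhds_basis_tsupport (I := 𝓡 7) p).mem_iff.1
    (ht.mem_nhds hpt)
  have h1 : ContMDiff (𝓡 7) ((𝓡 7).prod 𝓘(ℝ, ℂ)) ∞
      (fun y => TotalSpace.mk' ℂ y (((f : X → ℝ) • σ) y)) :=
    ContMDiffOn.smul_section_of_tsupport (f.contMDiff.contMDiffOn) ht hf (hσ.mono hts)
  have h2 := D.smooth.contMDiff.contMDiff (σ := (f : X → ℝ) • σ) (by simpa using h1.contMDiffOn)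
  have h3 : (fun y => TotalSpace.mk' ℂ y (D.toFun σ y (V y))) =ᶠ[𝓝 p]
      (fun y => TotalSpace.mk' ℂ y (D.toFun ((f : X → ℝ) • σ) y (V y))) := by
    have h4 := f.eventuallyEq_one.eventually_nhds
    filter_upwards [h4, ht.mem_nhds hpt] with y hy hyt
    have : D.toFun σ y = D.toFun ((f : X → ℝ) • σ) y := by
      refine D.isCovariantDerivativeOn.congr_of_eventuallyEq (s := Set.univ) ?_ ?_ univ_mem ?_
      · exact ((hσ.mono hts).contMDiffAt (ht.mem_nhds hyt)).mdifferentiableAt (by simp)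
      · exact h1.contMDiffAt.mdifferentiableAt (by simp)
      · filter_upwards [hy] with z hz
        simp [hz]
    rw [this]
  refine MDifferentiableAt.congr_of_eventuallyEq ?_ h3
  exact MDifferentiableAt.clm_bundle_apply (F₁ := EuclideanSpace ℝ (Fin 7)) (F₂ := ℂ)
    ((h2.contMDiffAt univ_mem).mdifferentiableAt (by simp)) hV

lemma curvatureOperator_swap (D : HermitianConnection L) (U V : Π x : X, TangentSpace (𝓡 7) x)
    (σ : Π x, L x) (p : X) :
    D.curvatureOperator U V σ p = - D.curvatureOperator V U σ p := by
  simp only [curvatureOperator]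
  rw [mlieBracket_swap_apply, map_neg]
  abel

section

variable [T2Space X] [ContMDiffVectorBundle ∞ ℂ L (𝓡 7)] (D : HermitianConnection L)

lemma mdifferentiableAt_apply_extend {p : X} (e : L p) (v : TangentSpace (𝓡 7) p) :
    MDifferentiableAt (𝓡 7) ((𝓡 7).prod 𝓘(ℝ, ℂ)) (fun y => TotalSpace.mk' ℂ y
      (D.toFun (localExtend ℂ e) y (localExtend (EuclideanSpace ℝ (Fin 7)) v y))) p := by
  obtain ⟨s, hs, hσ⟩ := contMDiffOn_localExtend (F := ℂ) (𝓡 7) e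
  exact D.mdifferentiableAt_apply hs hσ (mdifferentiableAt_localExtend _ _)

lemma curvatureOperator_add_left {p : X} (e : L p) (u u' v : TangentSpace (𝓡 7) p) :
    D.curvatureOperator (localExtend (EuclideanSpace ℝ (Fin 7)) (u + u'))
        (localExtend (EuclideanSpace ℝ (Fin 7)) v) (localExtend ℂ e) p =
      D.curvatureOperator (localExtend (EuclideanSpace ℝ (Fin 7)) u)
        (localExtend (EuclideanSpace ℝ (Fin 7)) v) (localExtend ℂ e) p +
      D.curvatureOperator (localExtend (EuclideanSpace ℝ (Fin 7)) u')
        (localExtend (EuclideanSpace ℝ (Fin 7)) v) (localExtend ℂ e) p := by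
  have h := D.isCovariantDerivativeOnUniv.add
    (D.mdifferentiableAt_apply_extend e u) (D.mdifferentiableAt_apply_extend e u') (by trivial)
  have hb := mlieBracket_add_left (I := 𝓡 7) (W := localExtend (EuclideanSpace ℝ (Fin 7)) v)
    (mdifferentiableAt_localExtend (F := EuclideanSpace ℝ (Fin 7)) (𝓡 7) u)
    (mdifferentiableAt_localExtend (F := EuclideanSpace ℝ (Fin 7)) (𝓡 7) u')
  have h' : (fun x => D.toFun (localExtend ℂ e) x
      ((localExtend (EuclideanSpace ℝ (Fin 7)) u + localExtend (EuclideanSpace ℝ (Fin 7)) u') x)) =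
      (fun x => D.toFun (localExtend ℂ e) x (localExtend (EuclideanSpace ℝ (Fin 7)) u x)) +
      (fun x => D.toFun (localExtend ℂ e) x (localExtend (EuclideanSpace ℝ (Fin 7)) u' x)) := by
    funext x
    simp
  simp only [curvatureOperator]
  rw [localExtend_add, hb, h', h]
  simp only [Pi.add_apply, map_add, add_apply]
  abel

lemma curvatureOperator_smul_left {p : X} (e : L p) (c : ℝ) (u v : TangentSpace (𝓡 7) p) :
    D.curvatureOperator (localExtend (EuclideanSpace ℝ (Fin 7)) (c • u))
        (localExtend (EuclideanSpace ℝ (Fin 7)) v) (localExtend ℂ e) p =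
      c • D.curvatureOperator (localExtend (EuclideanSpace ℝ (Fin 7)) u)
        (localExtend (EuclideanSpace ℝ (Fin 7)) v) (localExtend ℂ e) p := by
  have h := D.isCovariantDerivativeOnUniv.smul_const c
    (D.mdifferentiableAt_apply_extend e u) (by trivial)
  have hb := mlieBracket_const_smul_left (I := 𝓡 7) (c := c)
    (W := localExtend (EuclideanSpace ℝ (Fin 7)) v)
    (mdifferentiableAt_localExtend (F := EuclideanSpace ℝ (Fin 7)) (𝓡 7) u)
  have h' : (fun x => D.toFun (localExtend ℂ e) x ((c • localExtend (EuclideanSpace ℝ (Fin 7)) u) x)) =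
      c • (fun x => D.toFun (localExtend ℂ e) x (localExtend (EuclideanSpace ℝ (Fin 7)) u x)) := by
    funext x
    simp
  simp only [curvatureOperator]
  rw [localExtend_smul, hb, h', h]
  simp only [Pi.smul_apply, map_smul, smul_apply, smul_sub]

/-- The curvature 2-form `F_∇` as a complex-valued 2-form: `F_∇(u, v)` is the complex number with
`∇_U ∇_V σ - ∇_V ∇_U σ - ∇_{[U, V]} σ = F_∇(u, v) σ` at `p`, where `U`, `V` and the section `σ`
are the extensions of `u`, `v` and of some `e ≠ 0` in the line `L_p` that are constant in the
preferred trivializations at `p`. -/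
def curvature (p : X) : TangentSpace (𝓡 7) p [⋀^Fin 2]→ₗ[ℝ] ℂ :=
  letI e : L p := (trivializationAt ℂ L p).symm p 1
  { toFun := fun w => inner ℂ e (D.curvatureOperator
      (localExtend (EuclideanSpace ℝ (Fin 7)) (w 0)) (localExtend (EuclideanSpace ℝ (Fin 7)) (w 1))
      (localExtend ℂ e) p) / inner ℂ e e
    map_update_add' := by
      intro _ w i x y
      fin_cases i
      · simp [curvatureOperator_add_left, add_div]
      · have h (a : TangentSpace (𝓡 7) p) := D.curvatureOperator_swap
          (localExtend (EuclideanSpace ℝ (Fin 7)) (w 0)) (localExtend (EuclideanSpace ℝ (Fin 7)) a)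
        simp only [Fin.mk_one, Function.update_self, ne_eq, zero_ne_one, not_false_eq_true,
          Function.update_of_ne, h, curvatureOperator_add_left, inner_add_right, inner_neg_right]
        ring
    map_update_smul' := by
      intro _ w i c x
      have hr (z : L p) : inner ℂ e (c • z) = (c : ℂ) * inner ℂ e z := by
        rw [← inner_smul_right, Complex.coe_smul]
      fin_cases i
      · simp only [Fin.zero_eta, Function.update_self, ne_eq, one_ne_zero, not_false_eq_true,
          Function.update_of_ne, curvatureOperator_smul_left, hr, Complex.real_smul]
        ring
      · have h (a : TangentSpace (𝓡 7) p) := D.curvatureOperator_swap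
          (localExtend (EuclideanSpace ℝ (Fin 7)) (w 0)) (localExtend (EuclideanSpace ℝ (Fin 7)) a)
        simp only [Fin.mk_one, Function.update_self, ne_eq, zero_ne_one, not_false_eq_true,
          Function.update_of_ne, h, curvatureOperator_smul_left, inner_neg_right, hr,
          Complex.real_smul]
        ring
    map_eq_zero_of_eq' := by
      intro w i j h hij
      have h01 : w 0 = w 1 := by
        fin_cases i <;> fin_cases j <;> simp_all
      simp [h01, curvatureOperator] }

end

end HermitianConnection

end Connection

/-! ### The curvature is imaginary-valued -/

section Reality

open FiberBundle VectorField Filter Set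
open scoped Topology

variable {X : Type*} [TopologicalSpace X] [ChartedSpace (EuclideanSpace ℝ (Fin 7)) X]
  [IsManifold (𝓡 7) ∞ X]

lemma localExtend_tangent {p : X} (v : TangentSpace (𝓡 7) p) {y : X}
    (hy : y ∈ (chartAt (EuclideanSpace ℝ (Fin 7)) p).source) :
    localExtend (EuclideanSpace ℝ (Fin 7)) v y = mfderivWithin 𝓘(ℝ, (EuclideanSpace ℝ (Fin 7))) (𝓡 7) (extChartAt (𝓡 7) p).symm (range (𝓡 7))
      (extChartAt (𝓡 7) p y) ((trivializationAt (EuclideanSpace ℝ (Fin 7)) (TangentSpace (𝓡 7)) p).linearMapAt ℝ p v) := by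
  rw [← TangentBundle.symmL_trivializationAt hy]
  rfl

lemma lieBracket_eq_zero_of_eventually_const {V W : (EuclideanSpace ℝ (Fin 7)) → (EuclideanSpace ℝ (Fin 7))} {s : Set (EuclideanSpace ℝ (Fin 7))} {x a b : (EuclideanSpace ℝ (Fin 7))}
    (hs : s = univ) (hV : V =ᶠ[𝓝 x] fun _ => a) (hW : W =ᶠ[𝓝 x] fun _ => b) :
    lieBracketWithin ℝ V W s x = 0 := by
  simp [hs, lieBracket, hV.fderiv_eq, hW.fderiv_eq]

lemma mlieBracket_localExtend {p : X} (u v : TangentSpace (𝓡 7) p) :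
    mlieBracket (𝓡 7) (localExtend (EuclideanSpace ℝ (Fin 7)) u) (localExtend (EuclideanSpace ℝ (Fin 7)) v) p = 0 := by
  have key (w : TangentSpace (𝓡 7) p) :
      mpullbackWithin 𝓘(ℝ, (EuclideanSpace ℝ (Fin 7))) (𝓡 7) (extChartAt (𝓡 7) p).symm (localExtend (EuclideanSpace ℝ (Fin 7)) w) (range (𝓡 7))
        =ᶠ[𝓝 (extChartAt (𝓡 7) p p)] fun _ =>
          (trivializationAt (EuclideanSpace ℝ (Fin 7)) (TangentSpace (𝓡 7)) p).linearMapAt ℝ p w := by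
    filter_upwards [extChartAt_target_mem_nhds (I := 𝓡 7) p] with x hx
    rw [mpullbackWithin_apply]
    have h1 : (extChartAt (𝓡 7) p).symm x ∈ (chartAt (EuclideanSpace ℝ (Fin 7)) p).source := by
      simpa using (extChartAt (𝓡 7) p).map_target hx
    rw [localExtend_tangent _ h1, (extChartAt (𝓡 7) p).right_inv hx]
    obtain ⟨A, hA⟩ := isInvertible_mfderivWithin_extChartAt_symm hx
    rw [← hA, ContinuousLinearMap.inverse_equiv]
    exact A.symm_apply_apply _
  rw [← mlieBracketWithin_univ, mlieBracketWithin_apply]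
  refine (congrArg _ (lieBracket_eq_zero_of_eventually_const (by simp) (key u) (key v))).trans (map_zero _)

lemma mvfderiv_congr {f g : X → ℝ} {p : X} (h : f =ᶠ[𝓝 p] g) :
    mvfderiv (𝓡 7) f p = mvfderiv (𝓡 7) g p := by
  ext v
  have := h.mfderiv_eq (I := 𝓡 7) (I' := 𝓘(ℝ, ℝ))
  change mfderiv (𝓡 7) 𝓘(ℝ, ℝ) f p v = mfderiv (𝓡 7) 𝓘(ℝ, ℝ) g p v
  rw [this]
  rfl

lemma mvfderiv_localExtend {p : X} {f : X → ℝ} (v : TangentSpace (𝓡 7) p) {y : X}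
    (hy : y ∈ (chartAt (EuclideanSpace ℝ (Fin 7)) p).source) (hf : MDifferentiableAt (𝓡 7) 𝓘(ℝ, ℝ) f y) :
    mvfderiv (𝓡 7) f y (localExtend (EuclideanSpace ℝ (Fin 7)) v y) =
      fderiv ℝ (f ∘ (extChartAt (𝓡 7) p).symm) (extChartAt (𝓡 7) p y)
        ((trivializationAt (EuclideanSpace ℝ (Fin 7)) (TangentSpace (𝓡 7)) p).linearMapAt ℝ p v) := by
  have hy' : y ∈ (extChartAt (𝓡 7) p).source := by simpa using hy
  rw [localExtend_tangent v hy]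
  have h := mvfderiv_comp_mfderivWithin_of_eq (I' := 𝓘(ℝ, (EuclideanSpace ℝ (Fin 7)))) (I := 𝓡 7) (g := f) (y := y)
    (f := (extChartAt (𝓡 7) p).symm) (s := range (𝓡 7)) (x := extChartAt (𝓡 7) p y) hf
    (mdifferentiableWithinAt_extChartAt_symm ((extChartAt (𝓡 7) p).map_source hy'))
    (by simpa using uniqueMDiffWithinAt_univ _) ((extChartAt (𝓡 7) p).left_inv hy')
  have h2 := DFunLike.congr_fun h
    ((trivializationAt (EuclideanSpace ℝ (Fin 7)) (TangentSpace (𝓡 7)) p).linearMapAt ℝ p v)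
  refine h2.symm.trans ?_
  simp only [mvfderivWithin, mfderivWithin_eq_fderivWithin]
  simp
  rfl

lemma mvfderiv_mvfderiv_comm {p : X} {f : X → ℝ} (u v : TangentSpace (𝓡 7) p)
    (hf : ContMDiffAt (𝓡 7) 𝓘(ℝ, ℝ) 2 f p) :
    mvfderiv (𝓡 7) (fun y => mvfderiv (𝓡 7) f y (localExtend (EuclideanSpace ℝ (Fin 7)) v y)) p u =
      mvfderiv (𝓡 7) (fun y => mvfderiv (𝓡 7) f y (localExtend (EuclideanSpace ℝ (Fin 7)) u y)) p v := by
  set g := f ∘ (extChartAt (𝓡 7) p).symm with hg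
  set T := (trivializationAt (EuclideanSpace ℝ (Fin 7)) (TangentSpace (𝓡 7)) p).linearMapAt ℝ p with hT
  have hgs : ContDiffAt ℝ 2 g (extChartAt (𝓡 7) p p) := by
    have := (contMDiffAt_iff.1 hf).2
    rw [ModelWithCorners.range_eq_univ, contDiffWithinAt_univ] at this
    exact this
  have hgd : DifferentiableAt ℝ (fderiv ℝ g) (extChartAt (𝓡 7) p p) :=
    (hgs.fderiv_right (m := 1) (by norm_num)).differentiableAt (by simp)
  have hsymm := hgs.isSymmSndFDerivAt (by simp)
  have key (v u : TangentSpace (𝓡 7) p) :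
      mvfderiv (𝓡 7) (fun y => mvfderiv (𝓡 7) f y (localExtend (EuclideanSpace ℝ (Fin 7)) v y)) p u =
        fderiv ℝ (fderiv ℝ g) (extChartAt (𝓡 7) p p) (T u) (T v) := by
    have hev : (fun y => mvfderiv (𝓡 7) f y (localExtend (EuclideanSpace ℝ (Fin 7)) v y)) =ᶠ[𝓝 p]
        (fun y => fderiv ℝ g (extChartAt (𝓡 7) p y) (T v)) := by
      filter_upwards [(chartAt (EuclideanSpace ℝ (Fin 7)) p).open_source.mem_nhds (mem_chart_source (EuclideanSpace ℝ (Fin 7)) p),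
        (contMDiffAt_iff_contMDiffAt_nhds (by simp)).1 hf] with y hy hfy
      exact mvfderiv_localExtend v hy (hfy.mdifferentiableAt (by simp))
    have hd : DifferentiableAt ℝ (fun x => fderiv ℝ g x (T v)) (extChartAt (𝓡 7) p p) :=
      hgd.clm_apply (differentiableAt_const _)
    have hm : MDifferentiableAt (𝓡 7) 𝓘(ℝ, ℝ) (fun y => fderiv ℝ g (extChartAt (𝓡 7) p y) (T v)) p :=
      hd.mdifferentiableAt.comp p (mdifferentiableAt_extChartAt (mem_chart_source (EuclideanSpace ℝ (Fin 7)) p))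
    have h1 := mvfderiv_localExtend u (mem_chart_source (EuclideanSpace ℝ (Fin 7)) p) hm
    rw [localExtend_self] at h1
    have hev' : ((fun y => fderiv ℝ g (extChartAt (𝓡 7) p y) (T v)) ∘ (extChartAt (𝓡 7) p).symm)
        =ᶠ[𝓝 (extChartAt (𝓡 7) p p)] fun x => fderiv ℝ g x (T v) := by
      filter_upwards [extChartAt_target_mem_nhds (I := 𝓡 7) p] with x hx
      simp only [Function.comp_apply, (extChartAt (𝓡 7) p).right_inv hx]
    have h2 : mvfderiv (𝓡 7) (fun y => mvfderiv (𝓡 7) f y (localExtend (EuclideanSpace ℝ (Fin 7)) v y)) p =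
        mvfderiv (𝓡 7) (fun y => fderiv ℝ g (extChartAt (𝓡 7) p y) (T v)) p :=
      mvfderiv_congr hev
    rw [h2, h1, hev'.fderiv_eq, fderiv_clm_apply hgd (differentiableAt_const _)]
    simp [hT]
  rw [key, key, hsymm.eq]


variable {L : X → Type*} [∀ x, NormedAddCommGroup (L x)] [∀ x, InnerProductSpace ℂ (L x)]
  [TopologicalSpace (TotalSpace ℂ L)] [FiberBundle ℂ L] [VectorBundle ℝ ℂ L]

variable (L) in
/-- The Hermitian metric of the complex line bundle `L`, given by the complex inner products of the
fibres, is smooth: it is a smooth section of the bundle of real bilinear maps `L × L → ℂ`. -/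
class IsSmoothHermitian : Prop where
  exists_contMDiff : ∃ h : Π x, L x →L[ℝ] L x →L[ℝ] ℂ,
    ContMDiff (𝓡 7) ((𝓡 7).prod 𝓘(ℝ, ℂ →L[ℝ] ℂ →L[ℝ] ℂ)) ∞
      (fun x => TotalSpace.mk' (ℂ →L[ℝ] ℂ →L[ℝ] ℂ)
        (E := fun x => L x →L[ℝ] L x →L[ℝ] Trivial X ℂ x) x (h x)) ∧
    ∀ (x : X) (v w : L x), inner ℂ v w = h x v w

variable [IsSmoothHermitian L]

lemma mdifferentiableAt_inner {σ τ : Π x, L x} {x : X}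
    (hσ : MDifferentiableAt (𝓡 7) ((𝓡 7).prod 𝓘(ℝ, ℂ)) (fun y => TotalSpace.mk' ℂ y (σ y)) x)
    (hτ : MDifferentiableAt (𝓡 7) ((𝓡 7).prod 𝓘(ℝ, ℂ)) (fun y => TotalSpace.mk' ℂ y (τ y)) x) :
    MDifferentiableAt (𝓡 7) 𝓘(ℝ, ℂ) (fun y => inner ℂ (σ y) (τ y)) x := by
  obtain ⟨h, hs, hh⟩ := IsSmoothHermitian.exists_contMDiff (L := L)
  simp only [hh]
  have : MDifferentiableAt (𝓡 7) ((𝓡 7).prod 𝓘(ℝ, ℂ))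
      (fun m => TotalSpace.mk' ℂ (E := Trivial X ℂ) m (h m (σ m) (τ m))) x := by
    apply MDifferentiableAt.clm_bundle_apply₂ (F₁ := ℂ) (F₂ := ℂ)
    · exact hs.contMDiffAt.mdifferentiableAt (by simp)
    · exact hσ
    · exact hτ
  simp only [mdifferentiableAt_totalSpace] at this
  exact this.2

lemma contMDiffAt_inner {σ τ : Π x, L x} {x : X}
    (hσ : ContMDiffAt (𝓡 7) ((𝓡 7).prod 𝓘(ℝ, ℂ)) ∞ (fun y => TotalSpace.mk' ℂ y (σ y)) x)
    (hτ : ContMDiffAt (𝓡 7) ((𝓡 7).prod 𝓘(ℝ, ℂ)) ∞ (fun y => TotalSpace.mk' ℂ y (τ y)) x) :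
    ContMDiffAt (𝓡 7) 𝓘(ℝ, ℂ) ∞ (fun y => inner ℂ (σ y) (τ y)) x := by
  obtain ⟨h, hs, hh⟩ := IsSmoothHermitian.exists_contMDiff (L := L)
  simp only [hh]
  have : ContMDiffAt (𝓡 7) ((𝓡 7).prod 𝓘(ℝ, ℂ)) ∞
      (fun m => TotalSpace.mk' ℂ (E := Trivial X ℂ) m (h m (σ m) (τ m))) x := by
    apply ContMDiffAt.clm_bundle_apply₂ (F₁ := ℂ) (F₂ := ℂ)
    · exact hs.contMDiffAt
    · exact hσ
    · exact hτ
  simp only [contMDiffAt_totalSpace] at this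
  exact this.2

namespace HermitianConnection
variable (D : HermitianConnection L)

lemma mvfderiv_re_inner {σ τ : Π x, L x} {x : X} (v : TangentSpace (𝓡 7) x)
    (hσ : MDifferentiableAt (𝓡 7) ((𝓡 7).prod 𝓘(ℝ, ℂ)) (fun y => TotalSpace.mk' ℂ y (σ y)) x)
    (hτ : MDifferentiableAt (𝓡 7) ((𝓡 7).prod 𝓘(ℝ, ℂ)) (fun y => TotalSpace.mk' ℂ y (τ y)) x) :
    MDifferentiableAt (𝓡 7) 𝓘(ℝ, ℝ) (fun y => (inner ℂ (σ y) (τ y)).re) x ∧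
    mvfderiv (𝓡 7) (fun y => (inner ℂ (σ y) (τ y)).re) x v =
      (inner ℂ (D.toFun σ x v) (τ x)).re + (inner ℂ (σ x) (D.toFun τ x v)).re := by
  have h := congrArg Complex.re (D.metric σ τ x v hσ hτ)
  have hd := mdifferentiableAt_inner hσ hτ
  have h2 : HasMFDerivAt (𝓡 7) 𝓘(ℝ, ℝ) (fun y => (inner ℂ (σ y) (τ y)).re) x
      (Complex.reCLM.comp (mvfderiv (𝓡 7) (fun y => inner ℂ (σ y) (τ y)) x)) :=
    (Complex.reCLM.hasMFDerivAt).comp x hd.hasMFDerivAt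
  have h3 : mvfderiv (𝓡 7) (fun y => (inner ℂ (σ y) (τ y)).re) x v =
      (mvfderiv (𝓡 7) (fun y => inner ℂ (σ y) (τ y)) x v).re :=
    DFunLike.congr_fun h2.mfderiv v
  refine ⟨h2.mdifferentiableAt, ?_⟩
  rw [h3, h, Complex.add_re]

variable [T2Space X] [ContMDiffVectorBundle ∞ ℂ L (𝓡 7)]

lemma re_inner_curvatureOperator {p : X} (u v : TangentSpace (𝓡 7) p) (e : L p) :
    (inner ℂ e (D.curvatureOperator (localExtend (EuclideanSpace ℝ (Fin 7)) u) (localExtend (EuclideanSpace ℝ (Fin 7)) v)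
      (localExtend ℂ e) p)).re = 0 := by
  set s := localExtend ℂ e with hs
  set f : X → ℝ := fun y => (inner ℂ (s y) (s y)).re with hf
  obtain ⟨t, ht, hst⟩ := contMDiffOn_localExtend (F := ℂ) (𝓡 7) e
  have hsp : ContMDiffAt (𝓡 7) ((𝓡 7).prod 𝓘(ℝ, ℂ)) ∞ (fun y => TotalSpace.mk' ℂ y (s y)) p :=
    hst.contMDiffAt ht
  have hfs : ContMDiffAt (𝓡 7) 𝓘(ℝ, ℝ) 2 f p :=
    (Complex.reCLM.contMDiff.contMDiffAt.comp p (contMDiffAt_inner hsp hsp)).of_le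
      (by simpa using WithTop.coe_le_coe.2 (le_top : (2 : ℕ∞) ≤ ⊤))
  have hsd := hsp.mdifferentiableAt (by simp)
  have hcomm {x : X} (a b : L x) : (inner ℂ a b).re = (inner ℂ b a).re :=
    inner_re_symm (𝕜 := ℂ) a b
  have key (u v : TangentSpace (𝓡 7) p) :
      mvfderiv (𝓡 7) (fun y => mvfderiv (𝓡 7) f y (localExtend (EuclideanSpace ℝ (Fin 7)) v y)) p u =
        2 * ((inner ℂ (D.toFun s p u) (D.toFun s p v)).re +
          (inner ℂ e (D.toFun (fun x => D.toFun s x (localExtend (EuclideanSpace ℝ (Fin 7)) v x)) p u)).re) := by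
    have h1 : (fun y => mvfderiv (𝓡 7) f y (localExtend (EuclideanSpace ℝ (Fin 7)) v y)) =ᶠ[𝓝 p]
        fun y => 2 * (inner ℂ (s y) (D.toFun s y (localExtend (EuclideanSpace ℝ (Fin 7)) v y))).re := by
      filter_upwards [eventually_mem_nhds_iff.2 ht] with y hy
      have hy' := (hst.contMDiffAt hy).mdifferentiableAt (by simp)
      rw [hf, (D.mvfderiv_re_inner _ hy' hy').2, hcomm]
      ring
    have hV := D.mdifferentiableAt_apply_extend e v
    obtain ⟨hin, h2⟩ := D.mvfderiv_re_inner u hsd hV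
    rw [mvfderiv_congr h1, mvfderiv_fun_mul mdifferentiableAt_const hin, mvfderiv_const]
    simp only [smul_zero, add_zero, smul_apply, h2]
    simp [hs]
  have h := mvfderiv_mvfderiv_comm u v hfs
  rw [key, key, hcomm (D.toFun s p u)] at h
  simp only [curvatureOperator, mlieBracket_localExtend, map_zero, sub_zero, localExtend_self,
    inner_sub_right, Complex.sub_re]
  linarith

/-- The curvature takes values in `iℝ`. -/
lemma curvature_re (p : X) (w : Fin 2 → TangentSpace (𝓡 7) p) : (D.curvature p w).re = 0 := by
  set e : L p := (trivializationAt ℂ L p).symm p 1 with he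
  have h := D.re_inner_curvatureOperator (w 0) (w 1) e
  have h2 : D.curvature p w = inner ℂ e (D.curvatureOperator (localExtend (EuclideanSpace ℝ (Fin 7)) (w 0))
    (localExtend (EuclideanSpace ℝ (Fin 7)) (w 1)) (localExtend ℂ e) p) / inner ℂ e e := rfl
  rw [h2, inner_self_eq_norm_sq_to_K]
  have h3 (z : ℂ) (r : ℝ) (hz : z.re = 0) : (z / (r : ℂ) ^ 2).re = 0 := by
    rw [← Complex.ofReal_pow, Complex.div_ofReal_re, hz, zero_div]
  exact h3 _ _ h

/-- Hence `-iF` is a real 2-form, and nothing is lost in taking its real part. -/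
lemma complexify_realPart_curvature (p : X) :
    complexify (realPart ((-Complex.I) • D.curvature p)) = (-Complex.I) • D.curvature p := by
  ext w
  have h := D.curvature_re p w
  apply Complex.ext <;> simp [complexify, realPart, h]

end HermitianConnection

end Reality

/-! ### G₂-structures on 7-manifolds -/

section G2Structure

open Filter
open scoped Topology

variable {X : Type*} [TopologicalSpace X] [ChartedSpace (EuclideanSpace ℝ (Fin 7)) X]
  [IsManifold (𝓡 7) ∞ X]

variable (X) in
/-- An orientation of a 7-manifold: an orientation of each tangent space such that near each point
there are smooth vector fields which form a positively oriented basis at every nearby point. -/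
structure ManifoldOrientation where
  at_point : ∀ p : X, Orientation ℝ (TangentSpace (𝓡 7) p) (Fin 7)
  exists_frame : ∀ p : X, ∃ U : Fin 7 → Π x : X, TangentSpace (𝓡 7) x,
    (∀ i, ContMDiffAt (𝓡 7) ((𝓡 7).prod 𝓘(ℝ, EuclideanSpace ℝ (Fin 7))) ∞
      (fun y => TotalSpace.mk' (EuclideanSpace ℝ (Fin 7)) y (U i y)) p) ∧
    ∀ᶠ x in 𝓝 p, ∃ b : Module.Basis (Fin 7) ℝ (TangentSpace (𝓡 7) x),
      (∀ i, b i = U i x) ∧ b.orientation = at_point x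

/-- A G₂-structure on an oriented 7-manifold: a smooth 3-form `φ` (smooth means that `φ(U, V, W)`
is a smooth function for all smooth vector fields) such that each tangent space has a positively
oriented basis in which `φ = e¹²³ + e¹⁴⁵ + e¹⁶⁷ + e²⁴⁶ - e²⁵⁷ - e³⁴⁷ - e³⁵⁶`. -/
structure G2Structure (o : ManifoldOrientation X) where
  form : ∀ p : X, TangentSpace (𝓡 7) p [⋀^Fin 3]→ₗ[ℝ] ℝ
  smooth : ∀ U : Fin 3 → Π x : X, TangentSpace (𝓡 7) x,
    (∀ i, ContMDiff (𝓡 7) ((𝓡 7).prod 𝓘(ℝ, EuclideanSpace ℝ (Fin 7))) ∞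
      (fun y => TotalSpace.mk' (EuclideanSpace ℝ (Fin 7)) y (U i y))) →
    ContMDiff (𝓡 7) 𝓘(ℝ, ℝ) ∞ (fun p => form p (fun i => U i p))
  exists_adapted : ∀ p : X, ∃ b : Module.Basis (Fin 7) ℝ (TangentSpace (𝓡 7) p),
    b.orientation = o.at_point p ∧ form p = modelG2Form b

namespace G2Structure

variable {o : ManifoldOrientation X} (φ : G2Structure o) (p : X)

/-- A positively oriented basis of `T_p X` in which `φ` has its standard form. All such bases are
orthonormal for the metric `g_φ` given by `g_φ(u, v) vol = (1/6) i(u)φ ∧ i(v)φ ∧ φ`; they differ by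
elements of `G₂ ⊆ SO(7)`, so the metric notions below do not depend on the choice. -/
def adaptedBasis : Module.Basis (Fin 7) ℝ (TangentSpace (𝓡 7) p) :=
  (φ.exists_adapted p).choose

lemma adaptedBasis_spec : (φ.adaptedBasis p).orientation = o.at_point p ∧
    φ.form p = modelG2Form (φ.adaptedBasis p) :=
  (φ.exists_adapted p).choose_spec

/-- The 3-form `φ` at `p`, as a complex-valued form. -/
def formC : TangentSpace (𝓡 7) p [⋀^Fin 3]→ₗ[ℝ] ℂ := complexify (φ.form p)

/-- The Hodge star operator of `g_φ` and the orientation on `k`-forms at `p`, `k + l = 7`. -/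
def star {k l : ℕ} (h : k + l = 7) (α : TangentSpace (𝓡 7) p [⋀^Fin k]→ₗ[ℝ] ℂ) :
    TangentSpace (𝓡 7) p [⋀^Fin l]→ₗ[ℝ] ℂ :=
  hodgeStar ((φ.adaptedBasis p).reindex (finCongr h.symm)) α

/-- The inner product of forms induced by `g_φ`. -/
def inner {k : ℕ} (α β : TangentSpace (𝓡 7) p [⋀^Fin k]→ₗ[ℝ] ℂ) : ℂ :=
  formInner (φ.adaptedBasis p) α β

/-- The squared norm of forms induced by `g_φ`. -/
def normSq {k : ℕ} (α : TangentSpace (𝓡 7) p [⋀^Fin k]→ₗ[ℝ] ℂ) : ℝ :=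
  formNormSq (φ.adaptedBasis p) α

/-- The 4-form `*φ`. -/
def starForm : TangentSpace (𝓡 7) p [⋀^Fin 4]→ₗ[ℝ] ℂ :=
  φ.star p (k := 3) (l := 4) rfl (φ.formC p)

/-- For a complex-valued 2-form `E` with real values, the endomorphism `E^♯ : u ↦ (i(u)E)^♯` of
`T_p X`, with respect to `g_φ`. -/
def sharp (E : TangentSpace (𝓡 7) p [⋀^Fin 2]→ₗ[ℝ] ℂ) :
    TangentSpace (𝓡 7) p →ₗ[ℝ] TangentSpace (𝓡 7) p :=
  sharpEnd (φ.adaptedBasis p) (realPart E)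

end G2Structure

variable [T2Space X] {L : X → Type*} [∀ x, NormedAddCommGroup (L x)]
  [∀ x, InnerProductSpace ℂ (L x)] [TopologicalSpace (TotalSpace ℂ L)] [FiberBundle ℂ L]
  [VectorBundle ℝ ℂ L] [ContMDiffVectorBundle ∞ ℂ L (𝓡 7)]

namespace HermitianConnection

/-- The 4-form `F² = F ∧ F`. -/
def curvatureSq (D : HermitianConnection L) (p : X) : TangentSpace (𝓡 7) p [⋀^Fin 4]→ₗ[ℝ] ℂ :=
  wedge (D.curvature p) (D.curvature p)

/-- The 6-form `F³ = F ∧ F ∧ F`. -/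
def curvatureCube (D : HermitianConnection L) (p : X) : TangentSpace (𝓡 7) p [⋀^Fin 6]→ₗ[ℝ] ℂ :=
  wedge (D.curvatureSq p) (D.curvature p)

/-- `∇` is a deformed Donaldson–Thomas connection for the G₂-structure `φ`:
`(1/6) F³ + F ∧ *φ = 0`. -/
def IsG2dDT (D : HermitianConnection L) {o : ManifoldOrientation X} (φ : G2Structure o) : Prop :=
  ∀ p : X, (1 / 6 : ℂ) • D.curvatureCube p + wedge (D.curvature p) (φ.starForm p) = 0

end HermitianConnection

end G2Structure

end G2dDT

end

open G2dDT

/-! Everything happens at one point. In an adapted basis the curvature is `F = iE` with `E` a real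
skew form with components `c` (`curvature_re`, `apply_eq_components`), so `F² = -E²` and `F³ =
-iE³`. The terms on the left become `(1 - h)²` with `h = ½⟨E², *φ⟩`, `|*φ ∧ E - E³/6|²` and `¼|φ ∧
*E²|²`.

On the right, `det(1 + E)` is the sum of the squared Pfaffians of all principal submatrices of even
order (`det_one_add_skew`), that is `1 + |E|² + |E²/2|² + |E³/6|²`. Comparing degrees in `E`, the
identity amounts to `|*φ ∧ E|² = |E|² + ⟨E², *φ⟩` in degree 2 and `h² - 2⟨*φ ∧ E, E³/6⟩ + ¼|φ ∧
*E²|² = |E²/2|²` in degree 4; degrees 0 and 6 agree trivially. Both are polynomial identities in the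
21 independent components, verified together in `model_identity`.

The inequality drops two nonnegative terms. Equality forces both to vanish, so in particular the dDT
equation holds. Conversely the dDT equation must kill the third term as well: contracting `E` with
the vector dual to `*φ ∧ E - E³/6` gives `½ φ ∧ *E²` up to sign and duality, because the vector dual
to `E³` lies in the kernel of `E` (`contraction_eq`).

The remaining work is to reach components from the invariant definitions. Wedge products and Hodge
stars are rewritten as signed sums over increasing multi-indices (`wedge_apply`, `hodgeStar_apply`),
then over explicit lists whose nonzero terms are found by kernel evaluation. -/

noncomputable section

namespace G2dDT

/-! ### Sums over increasing multi-indices -/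

/-- The strictly increasing maps `Fin k → Fin n`. -/
def increasingMaps : (k n : ℕ) → List (Fin k → Fin n)
  | 0, _ => [Fin.elim0]
  | _ + 1, 0 => []
  | k + 1, n + 1 => (increasingMaps k n).map (fun f => Fin.cons 0 (Fin.succ ∘ f)) ++
      (increasingMaps (k + 1) n).map (Fin.succ ∘ ·)

lemma mem_increasingMaps {k n : ℕ} {f : Fin k → Fin n} : f ∈ increasingMaps k n ↔ StrictMono f := by
  induction n generalizing k with
  | zero =>
    cases k with
    | zero => simpa [increasingMaps, Subsingleton.elim f Fin.elim0] using Subsingleton.strictMono _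
    | succ k => exact (f 0).elim0
  | succ n ih =>
    cases k with
    | zero => simpa [increasingMaps, Subsingleton.elim f Fin.elim0] using Subsingleton.strictMono _
    | succ k =>
      simp only [increasingMaps, List.mem_append, List.mem_map, ih]
      constructor
      · rintro (⟨g, hg, rfl⟩ | ⟨g, hg, rfl⟩)
        · intro i j
          refine Fin.cases ?_ (fun i => ?_) i <;> refine Fin.cases ?_ (fun j => ?_) j
          · simp
          · simp
          · simp
          · simpa using fun h => hg h
        · exact Fin.strictMono_succ.comp hg
      · intro hf
        by_cases h0 : f 0 = 0
        · left
          have h (i : Fin k) : f i.succ ≠ 0 := by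
            have := hf (Fin.succ_pos i)
            rw [h0] at this
            exact this.ne'
          refine ⟨fun i => (f i.succ).pred (h i), fun i j hij => ?_, ?_⟩
          · simpa using hf (Fin.succ_lt_succ_iff.2 hij)
          · funext i
            refine Fin.cases ?_ (fun j => ?_) i <;> simp [h0]
        · right
          have h (i : Fin (k + 1)) : f i ≠ 0 := by
            have := (Fin.pos_iff_ne_zero.2 h0).trans_le (hf.monotone (Fin.zero_le i))
            exact this.ne'
          refine ⟨fun i => (f i).pred (h i), fun i j hij => ?_, ?_⟩
          · simpa using hf hij
          · funext i
            simp

lemma nodup_increasingMaps (k n : ℕ) : (increasingMaps k n).Nodup := by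
  induction n generalizing k with
  | zero => cases k <;> simp [increasingMaps]
  | succ n ih =>
    cases k with
    | zero => simp [increasingMaps]
    | succ k =>
      refine List.Nodup.append ((ih k).map fun f g h => ?_) ((ih _).map fun f g h => ?_) ?_
      · funext i
        simpa using congrFun h i.succ
      · funext i
        simpa using congrFun h i
      · intro f h1 h2
        simp only [List.mem_map] at h1 h2
        obtain ⟨g, -, rfl⟩ := h1
        obtain ⟨g', -, h⟩ := h2
        simpa using congrFun h 0

/-- Replaces the abstract finite type of order embeddings by a recursively built list, which the
kernel can evaluate. -/
lemma sum_orderEmbedding {M : Type*} [AddCommMonoid M] {k n : ℕ} (g : (Fin k → Fin n) → M) :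
    ∑ I : Fin k ↪o Fin n, g I = ((increasingMaps k n).map g).sum := by
  classical
  rw [← List.sum_toFinset g (nodup_increasingMaps k n)]
  refine Finset.sum_bij (fun I _ => I) (fun I _ => ?_) (fun I _ J _ h => DFunLike.coe_injective h)
    (fun f hf => ?_) (fun _ _ => rfl)
  · simpa [mem_increasingMaps] using I.strictMono
  · simp only [List.mem_toFinset, mem_increasingMaps] at hf
    exact ⟨OrderEmbedding.ofStrictMono f hf, Finset.mem_univ _, rfl⟩

/-- A sum over all multi-indices of a symmetric function that vanishes off the injective ones. -/
lemma sum_symmetric {M : Type*} [AddCommMonoid M] {k n : ℕ} (g : (Fin k → Fin n) → M)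
    (hsymm : ∀ f (σ : Equiv.Perm (Fin k)), g (f ∘ σ) = g f)
    (hinj : ∀ f, ¬ Function.Injective f → g f = 0) :
    ∑ f, g f = k.factorial • ∑ I : Fin k ↪o Fin n, g I := by
  classical
  -- An injective multi-index is uniquely an increasing one composed with a permutation: sorting
  -- gives existence, and the range determines the increasing part.
  have h : ∑ f with Function.Injective f, g f =
      ∑ x : (Fin k ↪o Fin n) × Equiv.Perm (Fin k), g x.1 := by
    symm
    refine Finset.sum_bij (fun x _ => x.1 ∘ x.2) (fun x _ => ?_) ?_ (fun f hf => ?_)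
      (fun x _ => (hsymm _ _).symm)
    · simpa using x.1.injective.comp x.2.injective
    · rintro ⟨I, σ⟩ - ⟨J, τ⟩ - h
      have hIJ : I = J := by
        have := congrArg Set.range h
        simp only [EquivLike.range_comp] at this
        exact DFunLike.coe_injective ((I.strictMono.range_inj J.strictMono).1 this)
      subst hIJ
      have : σ = τ := Equiv.ext fun i => I.injective (congrFun h i)
      rw [this]
    · simp only [Finset.mem_filter, Finset.mem_univ, true_and] at hf
      refine ⟨⟨OrderEmbedding.ofStrictMono (f ∘ Tuple.sort f)
        ((Tuple.monotone_sort f).strictMono_of_injective (hf.comp (Equiv.injective _))),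
        (Tuple.sort f)⁻¹⟩, Finset.mem_univ _, ?_⟩
      funext i
      simp
  rw [← Finset.sum_filter_of_ne (p := Function.Injective) fun f _ hf => not_imp_comm.1 (hinj f) hf, h,
    Fintype.sum_prod_type]
  simp [Fintype.card_perm, Finset.smul_sum]

/-! ### Signs of multi-indices -/

/-- The sign of a map `Fin n → Fin n`, zero if the map is not a permutation. -/
def signMap {n : ℕ} (f : Fin n → Fin n) : ℤ :=
  ∏ i, ∏ j, if i < j then (if f i < f j then 1 else if f j < f i then -1 else 0) else 1

lemma signMap_perm {n : ℕ} (σ : Equiv.Perm (Fin n)) : signMap σ = Equiv.Perm.sign σ := by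
  rw [Equiv.Perm.sign_eq_prod_prod_Ioi, signMap]
  push_cast
  refine Finset.prod_congr rfl fun i _ => ?_
  rw [← Finset.prod_filter]
  refine Finset.prod_congr (by ext; simp) fun j hj => ?_
  have hij : σ i ≠ σ j := σ.injective.ne (Finset.mem_Ioi.1 hj).ne
  rcases hij.lt_or_gt with h | h
  · simp [h]
  · simp [h, h.not_gt]

lemma signMap_of_not_injective {n : ℕ} {f : Fin n → Fin n} (hf : ¬ Function.Injective f) :
    signMap f = 0 := by
  have : ∃ i j, i < j ∧ f i = f j := by
    simp only [Function.Injective, not_forall] at hf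
    obtain ⟨i, j, h, hij⟩ := hf
    rcases (show i ≠ j from hij).lt_or_gt with h' | h'
    · exact ⟨i, j, h', h⟩
    · exact ⟨j, i, h', h.symm⟩
  obtain ⟨i, j, hij, h⟩ := this
  refine Finset.prod_eq_zero (Finset.mem_univ i) (Finset.prod_eq_zero (Finset.mem_univ j) ?_)
  simp [hij, h]

/-- Since `signMap` vanishes off permutations, one formula covers repeated and permuted arguments
alike. -/
lemma alternatingMap_comp_map {n : ℕ} {V N : Type*} [AddCommGroup V] [Module ℝ V]
    [AddCommGroup N] [Module ℝ N] (w : V [⋀^Fin n]→ₗ[ℝ] N) (v : Fin n → V) (f : Fin n → Fin n) :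
    w (v ∘ f) = signMap f • w v := by
  by_cases hf : Function.Injective f
  · obtain ⟨σ, rfl⟩ : ∃ σ : Equiv.Perm (Fin n), σ = f :=
      ⟨Equiv.ofBijective f (Finite.injective_iff_bijective.1 hf), rfl⟩
    rw [w.map_perm, signMap_perm]
    rfl
  · rw [signMap_of_not_injective hf, zero_smul]
    refine w.map_eq_zero_of_not_injective _ fun h => hf h.of_comp

lemma signMap_comp_perm {n : ℕ} (f : Fin n → Fin n) (σ : Equiv.Perm (Fin n)) :
    signMap (f ∘ σ) = signMap f * Equiv.Perm.sign σ := by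
  by_cases hf : Function.Injective f
  · obtain ⟨τ, rfl⟩ : ∃ τ : Equiv.Perm (Fin n), τ = f :=
      ⟨Equiv.ofBijective f (Finite.injective_iff_bijective.1 hf), rfl⟩
    rw [← Equiv.Perm.coe_mul, signMap_perm, signMap_perm, Equiv.Perm.sign_mul]
    simp
  · rw [signMap_of_not_injective hf, signMap_of_not_injective, zero_mul]
    rwa [Function.Injective.of_comp_iff' _ σ.bijective]

lemma signMap_append_left {k l : ℕ} (I : Fin k → Fin (k + l)) (J : Fin l → Fin (k + l))
    (σ : Equiv.Perm (Fin k)) :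
    signMap (Fin.append (I ∘ σ) J) = signMap (Fin.append I J) * Equiv.Perm.sign σ := by
  have h : Fin.append (I ∘ σ) J =
      Fin.append I J ∘ finSumFinEquiv.permCongr (Equiv.Perm.sumCongr σ 1) := by
    funext i
    refine Fin.addCases (fun i => ?_) (fun i => ?_) i <;> simp [Equiv.permCongr_apply]
  rw [h, signMap_comp_perm, Equiv.Perm.sign_permCongr, Equiv.Perm.sign_sumCongr]
  simp

lemma signMap_append_right {k l : ℕ} (I : Fin k → Fin (k + l)) (J : Fin l → Fin (k + l))
    (σ : Equiv.Perm (Fin l)) :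
    signMap (Fin.append I (J ∘ σ)) = signMap (Fin.append I J) * Equiv.Perm.sign σ := by
  have h : Fin.append I (J ∘ σ) =
      Fin.append I J ∘ finSumFinEquiv.permCongr (Equiv.Perm.sumCongr 1 σ) := by
    funext i
    refine Fin.addCases (fun i => ?_) (fun i => ?_) i <;> simp [Equiv.permCongr_apply]
  rw [h, signMap_comp_perm, Equiv.Perm.sign_permCongr, Equiv.Perm.sign_sumCongr]
  simp

/-! ### Wedge products and Hodge stars in terms of multi-indices -/

section

variable {V : Type*} [AddCommGroup V] [Module ℝ V]

/-- The shuffle product takes one representative per coset of `S_k × S_l`, while alternating the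
tensor product sums over all of `S_{k+l}` and counts each coset `k! l!` times. Keeping the factor on
the left avoids division in `A`. -/
lemma factorial_smul_wedge_apply {A : Type*} [CommRing A] [Algebra ℝ A] {k l : ℕ}
    (α : V [⋀^Fin k]→ₗ[ℝ] A) (β : V [⋀^Fin l]→ₗ[ℝ] A) (v : Fin (k + l) → V) :
    (k.factorial * l.factorial) • wedge α β v = ∑ σ : Equiv.Perm (Fin (k + l)),
      (Equiv.Perm.sign σ : ℤ) • (α (v ∘ σ ∘ Fin.castAdd l) * β (v ∘ σ ∘ Fin.natAdd k)) := by
  have h := congrArg (LinearMap.mul' ℝ A)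
    (DFunLike.congr_fun (MultilinearMap.domCoprod_alternization_eq α β) (v ∘ finSumFinEquiv))
  simp only [Fintype.card_fin, AlternatingMap.smul_apply, map_nsmul] at h
  refine Eq.trans h.symm ?_
  rw [MultilinearMap.alternatization_apply, map_sum]
  refine Fintype.sum_equiv (Equiv.permCongr finSumFinEquiv) _ _ fun σ => ?_
  simp only [Equiv.Perm.sign_permCongr]
  rw [MultilinearMap.domDomCongr_apply, MultilinearMap.domCoprod_apply]
  have hl : (v ∘ finSumFinEquiv.permCongr σ ∘ Fin.castAdd l) =
      fun i => (v ∘ finSumFinEquiv) (σ (Sum.inl i)) := by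
    funext i; simp [Equiv.permCongr_apply]
  have hr : (v ∘ finSumFinEquiv.permCongr σ ∘ Fin.natAdd k) =
      fun i => (v ∘ finSumFinEquiv) (σ (Sum.inr i)) := by
    funext i; simp [Equiv.permCongr_apply]
  rw [hl, hr]
  rcases Int.units_eq_one_or (Equiv.Perm.sign σ) with h | h <;> simp [h]

/-- The sum over permutations extends to all self-maps of the index set, the others having sign
zero. A self-map is a pair `(I, J)` of unrestricted multi-indices; each summand is symmetric in `I`
and in `J`, so restricting both to increasing ones produces exactly the factor `k! l!` of
`factorial_smul_wedge_apply`. -/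
lemma wedge_apply {k l : ℕ} (α : V [⋀^Fin k]→ₗ[ℝ] ℂ) (β : V [⋀^Fin l]→ₗ[ℝ] ℂ)
    (v : Fin (k + l) → V) :
    wedge α β v = ∑ I : Fin k ↪o Fin (k + l), ∑ J : Fin l ↪o Fin (k + l),
      (signMap (Fin.append I J) : ℂ) * (α (v ∘ I) * β (v ∘ J)) := by
  classical
  have h1 : ∑ σ : Equiv.Perm (Fin (k + l)),
      (Equiv.Perm.sign σ : ℤ) • (α (v ∘ σ ∘ Fin.castAdd l) * β (v ∘ σ ∘ Fin.natAdd k)) =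
      ∑ f : Fin (k + l) → Fin (k + l),
        (signMap f : ℂ) * (α (v ∘ f ∘ Fin.castAdd l) * β (v ∘ f ∘ Fin.natAdd k)) := by
    symm
    rw [← Finset.sum_filter_of_ne (p := Function.Injective)
      fun f _ hf => not_imp_comm.1 signMap_of_not_injective fun h => hf (by simp [h])]
    symm
    refine Finset.sum_bij (fun σ _ => σ) (fun σ _ => ?_)
      (fun σ _ τ _ h => DFunLike.coe_injective h) (fun f hf => ?_) (fun σ _ => ?_)
    · simpa using σ.injective
    · exact ⟨Equiv.ofBijective f (Finite.injective_iff_bijective.1 (by simpa using hf)),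
        Finset.mem_univ _, rfl⟩
    · rw [signMap_perm, zsmul_eq_mul]
  have h2 : ∑ f : Fin (k + l) → Fin (k + l),
        (signMap f : ℂ) * (α (v ∘ f ∘ Fin.castAdd l) * β (v ∘ f ∘ Fin.natAdd k)) =
      ∑ I : Fin k → Fin (k + l), ∑ J : Fin l → Fin (k + l),
        (signMap (Fin.append I J) : ℂ) * (α (v ∘ I) * β (v ∘ J)) := by
    rw [← (Fin.appendEquiv k l).sum_comp, Fintype.sum_prod_type]
    refine Finset.sum_congr rfl fun I _ => Finset.sum_congr rfl fun J _ => ?_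
    have hI : Fin.append I J ∘ Fin.castAdd l = I := by ext i; simp
    have hJ : Fin.append I J ∘ Fin.natAdd k = J := by ext i; simp
    simp [Fin.appendEquiv, hI, hJ]
  have hl (I : Fin k → Fin (k + l)) : ∑ J : Fin l → Fin (k + l),
        (signMap (Fin.append I J) : ℂ) * (α (v ∘ I) * β (v ∘ J)) =
      l.factorial • ∑ J : Fin l ↪o Fin (k + l),
        (signMap (Fin.append I J) : ℂ) * (α (v ∘ I) * β (v ∘ J)) := by
    refine sum_symmetric (fun J => (signMap (Fin.append I J) : ℂ) * (α (v ∘ I) * β (v ∘ J)))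
      (fun J σ => ?_) fun J hJ => ?_
    · rw [← Function.comp_assoc, β.map_perm, signMap_append_right]
      rcases Int.units_eq_one_or (Equiv.Perm.sign σ) with h | h <;> simp [h]
    · rw [signMap_of_not_injective, Int.cast_zero, zero_mul]
      exact fun h => hJ (Fin.append_injective_iff.1 h).2.1
  have hk : ∑ I : Fin k → Fin (k + l), ∑ J : Fin l ↪o Fin (k + l),
        (signMap (Fin.append I J) : ℂ) * (α (v ∘ I) * β (v ∘ J)) =
      k.factorial • ∑ I : Fin k ↪o Fin (k + l), ∑ J : Fin l ↪o Fin (k + l),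
        (signMap (Fin.append I J) : ℂ) * (α (v ∘ I) * β (v ∘ J)) := by
    refine sum_symmetric (fun I => ∑ J : Fin l ↪o Fin (k + l),
        (signMap (Fin.append I J) : ℂ) * (α (v ∘ I) * β (v ∘ J)))
      (fun I σ => Finset.sum_congr rfl fun J _ => ?_) fun I hI => Finset.sum_eq_zero fun J _ => ?_
    · rw [← Function.comp_assoc, α.map_perm, signMap_append_left]
      rcases Int.units_eq_one_or (Equiv.Perm.sign σ) with h | h <;> simp [h]
    · rw [signMap_of_not_injective, Int.cast_zero, zero_mul]
      exact fun h => hI (Fin.append_injective_iff.1 h).1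
  have h := factorial_smul_wedge_apply α β v
  simp only [h1, h2, hl, ← Finset.smul_sum, hk, smul_smul] at h
  rw [mul_comm l.factorial] at h
  -- The common factor `k! l!` is cancelled in `ℂ`.
  exact nsmul_right_injective (by positivity) h

/-- The value of `*α` on vectors of the oriented orthonormal basis. -/
lemma hodgeStar_apply {k l : ℕ} (b : Module.Basis (Fin (k + l)) ℝ V) (α : V [⋀^Fin k]→ₗ[ℝ] ℂ)
    (J : Fin l → Fin (k + l)) :
    hodgeStar b α (b ∘ J) =
      ∑ I : Fin k ↪o Fin (k + l), (signMap (Fin.append I J) : ℂ) * α (b ∘ I) := by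
  have h0 : hodgeStar b α (b ∘ J) = ∑ I : Fin k ↪o Fin (k + l),
      α (b ∘ I) * complexify (interiorMul (b ∘ I) b.det) (b ∘ J) := by
    let ev : (V [⋀^Fin l]→ₗ[ℝ] ℂ) →+ ℂ := ⟨⟨fun γ => γ (b ∘ J), rfl⟩, fun _ _ => rfl⟩
    exact map_sum ev _ _
  rw [h0]
  refine Finset.sum_congr rfl fun I _ => ?_
  have h : Fin.append (b ∘ I) (b ∘ J) = b ∘ Fin.append I J := by
    funext i
    refine Fin.addCases (fun i => ?_) (fun i => ?_) i <;> simp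
  have h2 : complexify (interiorMul (b ∘ I) b.det) (b ∘ J) =
      ((b.det (b ∘ Fin.append I J) : ℝ) : ℂ) := by
    rw [← h]; rfl
  rw [h2, alternatingMap_comp_map, b.det_self, mul_comm]
  simp

/-- Forms agree if they agree on increasing families of basis vectors. -/
lemma form_ext {n k : ℕ} {N : Type*} [AddCommGroup N] [Module ℝ N] (b : Module.Basis (Fin n) ℝ V)
    {α β : V [⋀^Fin k]→ₗ[ℝ] N} (h : ∀ I : Fin k ↪o Fin n, α (b ∘ I) = β (b ∘ I)) : α = β := by
  refine b.ext_alternating fun f hf => ?_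
  have hI := h (OrderEmbedding.ofStrictMono (f ∘ Tuple.sort f)
        ((Tuple.monotone_sort f).strictMono_of_injective (hf.comp (Equiv.injective _))))
  -- Sorting an injective family of indices changes the value of any form by a sign that depends on
  -- the family alone.
  have h2 (γ : V [⋀^Fin k]→ₗ[ℝ] N) : γ (b ∘ f) =
      Equiv.Perm.sign (Tuple.sort f)⁻¹ • γ (b ∘ f ∘ Tuple.sort f) := by
    rw [← γ.map_perm]
    congr 1
    funext i
    simp
  exact (h2 α).trans ((congrArg _ hI).trans (h2 β).symm)

lemma formNormSq_eq_zero {n k : ℕ} (b : Module.Basis (Fin n) ℝ V) {α : V [⋀^Fin k]→ₗ[ℝ] ℂ} :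
    formNormSq b α = 0 ↔ α = 0 := by
  refine ⟨fun h => form_ext b fun I => ?_, fun h => by simp [h, formNormSq]⟩
  rw [formNormSq, Finset.sum_eq_zero_iff_of_nonneg fun _ _ => by positivity] at h
  simpa using h I (Finset.mem_univ I)

end

/-- Discarding the terms with zero coefficient leaves lists short enough to be written out; every
table below enters through this lemma. -/
lemma sum_map_filter_coeff {ι : Type*} (l : List ι) (c : ι → ℤ) (g : ι → ℂ) :
    (l.map fun i => (c i : ℂ) * g i).sum = ((l.filter (c · ≠ 0)).map fun i => (c i : ℂ) * g i).sum := by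
  induction l with
  | nil => rfl
  | cons i l ih =>
    by_cases h : c i = 0 <;> simp [ih, h]

/-- The signed pairs of complementary increasing multi-indices. -/
def shuffles (k l : ℕ) : List (ℤ × (Fin k → Fin (k + l)) × (Fin l → Fin (k + l))) :=
  ((increasingMaps k (k + l)).flatMap fun I => (increasingMaps l (k + l)).map fun J =>
    (signMap (Fin.append I J), I, J)).filter (·.1 ≠ 0)

section

variable {V : Type*} [AddCommGroup V] [Module ℝ V]

lemma wedge_apply_shuffles {k l : ℕ} (α : V [⋀^Fin k]→ₗ[ℝ] ℂ) (β : V [⋀^Fin l]→ₗ[ℝ] ℂ)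
    (v : Fin (k + l) → V) :
    wedge α β v = ((shuffles k l).map fun s => (s.1 : ℂ) * (α (v ∘ s.2.1) * β (v ∘ s.2.2))).sum := by
  refine Eq.trans ?_ (sum_map_filter_coeff _
    (fun s : ℤ × (Fin k → Fin (k + l)) × (Fin l → Fin (k + l)) => s.1)
    (fun s => α (v ∘ s.2.1) * β (v ∘ s.2.2)))
  rw [wedge_apply]
  rw [sum_orderEmbedding (fun I => ∑ J : Fin l ↪o Fin (k + l),
      (signMap (Fin.append I J) : ℂ) * (α (v ∘ I) * β (v ∘ J))), List.map_flatMap, List.flatMap_def,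
    List.sum_flatten, List.map_map]
  congr 2
  funext I
  rw [sum_orderEmbedding (fun J => (signMap (Fin.append I J) : ℂ) * (α (v ∘ I) * β (v ∘ J))),
    Function.comp_apply, List.map_map]
  rfl

end

/-! ### Explicit wedge products in low degrees -/

lemma comp_vecCons {n : ℕ} {α β : Type*} (f : α → β) (a : α) (x : Fin n → α) :
    f ∘ Matrix.vecCons a x = Matrix.vecCons (f a) (f ∘ x) := by
  funext i
  refine Fin.cases ?_ (fun i => ?_) i <;> simp

lemma comp_vecEmpty {α β : Type*} (f : α → β) : f ∘ ![] = ![] :=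
  Subsingleton.elim _ _

lemma shuffles_two_two : shuffles 2 2 = [
    (1, ![0, 1], ![2, 3]), (-1, ![0, 2], ![1, 3]), (1, ![0, 3], ![1, 2]), (1, ![1, 2], ![0, 3]),
    (-1, ![1, 3], ![0, 2]), (1, ![2, 3], ![0, 1])] := by
  decide +kernel

lemma wedge_two_two {V : Type*} [AddCommGroup V] [Module ℝ V] (α : V [⋀^Fin 2]→ₗ[ℝ] ℂ)
    (β : V [⋀^Fin 2]→ₗ[ℝ] ℂ) (x0 x1 x2 x3 : V) : wedge α β ![x0, x1, x2, x3] =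
      α ![x0, x1] * β ![x2, x3] - α ![x0, x2] * β ![x1, x3] + α ![x0, x3] * β ![x1, x2]
      + α ![x1, x2] * β ![x0, x3] - α ![x1, x3] * β ![x0, x2] + α ![x2, x3] * β ![x0, x1] := by
  rw [wedge_apply_shuffles, shuffles_two_two]
  simp [comp_vecCons, comp_vecEmpty]
  ring

lemma shuffles_two_four : shuffles 2 4 = [
    (1, ![0, 1], ![2, 3, 4, 5]), (-1, ![0, 2], ![1, 3, 4, 5]), (1, ![0, 3], ![1, 2, 4, 5]),
    (-1, ![0, 4], ![1, 2, 3, 5]), (1, ![0, 5], ![1, 2, 3, 4]), (1, ![1, 2], ![0, 3, 4, 5]),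
    (-1, ![1, 3], ![0, 2, 4, 5]), (1, ![1, 4], ![0, 2, 3, 5]), (-1, ![1, 5], ![0, 2, 3, 4]),
    (1, ![2, 3], ![0, 1, 4, 5]), (-1, ![2, 4], ![0, 1, 3, 5]), (1, ![2, 5], ![0, 1, 3, 4]),
    (1, ![3, 4], ![0, 1, 2, 5]), (-1, ![3, 5], ![0, 1, 2, 4]), (1, ![4, 5], ![0, 1, 2, 3])] := by
  decide +kernel

lemma wedge_two_four {V : Type*} [AddCommGroup V] [Module ℝ V] (α : V [⋀^Fin 2]→ₗ[ℝ] ℂ)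
    (β : V [⋀^Fin 4]→ₗ[ℝ] ℂ) (x0 x1 x2 x3 x4 x5 : V) : wedge α β ![x0, x1, x2, x3, x4, x5] =
      α ![x0, x1] * β ![x2, x3, x4, x5] - α ![x0, x2] * β ![x1, x3, x4, x5]
      + α ![x0, x3] * β ![x1, x2, x4, x5] - α ![x0, x4] * β ![x1, x2, x3, x5]
      + α ![x0, x5] * β ![x1, x2, x3, x4] + α ![x1, x2] * β ![x0, x3, x4, x5]
      - α ![x1, x3] * β ![x0, x2, x4, x5] + α ![x1, x4] * β ![x0, x2, x3, x5]
      - α ![x1, x5] * β ![x0, x2, x3, x4] + α ![x2, x3] * β ![x0, x1, x4, x5]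
      - α ![x2, x4] * β ![x0, x1, x3, x5] + α ![x2, x5] * β ![x0, x1, x3, x4]
      + α ![x3, x4] * β ![x0, x1, x2, x5] - α ![x3, x5] * β ![x0, x1, x2, x4]
      + α ![x4, x5] * β ![x0, x1, x2, x3] := by
  rw [wedge_apply_shuffles, shuffles_two_four]
  simp [comp_vecCons, comp_vecEmpty]
  ring

lemma shuffles_four_two : shuffles 4 2 = [
    (1, ![0, 1, 2, 3], ![4, 5]), (-1, ![0, 1, 2, 4], ![3, 5]), (1, ![0, 1, 2, 5], ![3, 4]),
    (1, ![0, 1, 3, 4], ![2, 5]), (-1, ![0, 1, 3, 5], ![2, 4]), (1, ![0, 1, 4, 5], ![2, 3]),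
    (-1, ![0, 2, 3, 4], ![1, 5]), (1, ![0, 2, 3, 5], ![1, 4]), (-1, ![0, 2, 4, 5], ![1, 3]),
    (1, ![0, 3, 4, 5], ![1, 2]), (1, ![1, 2, 3, 4], ![0, 5]), (-1, ![1, 2, 3, 5], ![0, 4]),
    (1, ![1, 2, 4, 5], ![0, 3]), (-1, ![1, 3, 4, 5], ![0, 2]), (1, ![2, 3, 4, 5], ![0, 1])] := by
  decide +kernel

lemma wedge_four_two {V : Type*} [AddCommGroup V] [Module ℝ V] (α : V [⋀^Fin 4]→ₗ[ℝ] ℂ)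
    (β : V [⋀^Fin 2]→ₗ[ℝ] ℂ) (x0 x1 x2 x3 x4 x5 : V) : wedge α β ![x0, x1, x2, x3, x4, x5] =
      α ![x0, x1, x2, x3] * β ![x4, x5] - α ![x0, x1, x2, x4] * β ![x3, x5]
      + α ![x0, x1, x2, x5] * β ![x3, x4] + α ![x0, x1, x3, x4] * β ![x2, x5]
      - α ![x0, x1, x3, x5] * β ![x2, x4] + α ![x0, x1, x4, x5] * β ![x2, x3]
      - α ![x0, x2, x3, x4] * β ![x1, x5] + α ![x0, x2, x3, x5] * β ![x1, x4]
      - α ![x0, x2, x4, x5] * β ![x1, x3] + α ![x0, x3, x4, x5] * β ![x1, x2]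
      + α ![x1, x2, x3, x4] * β ![x0, x5] - α ![x1, x2, x3, x5] * β ![x0, x4]
      + α ![x1, x2, x4, x5] * β ![x0, x3] - α ![x1, x3, x4, x5] * β ![x0, x2]
      + α ![x2, x3, x4, x5] * β ![x0, x1] := by
  rw [wedge_apply_shuffles, shuffles_four_two]
  simp [comp_vecCons, comp_vecEmpty]
  ring

lemma shuffles_three_three : shuffles 3 3 = [
    (1, ![0, 1, 2], ![3, 4, 5]), (-1, ![0, 1, 3], ![2, 4, 5]), (1, ![0, 1, 4], ![2, 3, 5]),
    (-1, ![0, 1, 5], ![2, 3, 4]), (1, ![0, 2, 3], ![1, 4, 5]), (-1, ![0, 2, 4], ![1, 3, 5]),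
    (1, ![0, 2, 5], ![1, 3, 4]), (1, ![0, 3, 4], ![1, 2, 5]), (-1, ![0, 3, 5], ![1, 2, 4]),
    (1, ![0, 4, 5], ![1, 2, 3]), (-1, ![1, 2, 3], ![0, 4, 5]), (1, ![1, 2, 4], ![0, 3, 5]),
    (-1, ![1, 2, 5], ![0, 3, 4]), (-1, ![1, 3, 4], ![0, 2, 5]), (1, ![1, 3, 5], ![0, 2, 4]),
    (-1, ![1, 4, 5], ![0, 2, 3]), (1, ![2, 3, 4], ![0, 1, 5]), (-1, ![2, 3, 5], ![0, 1, 4]),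
    (1, ![2, 4, 5], ![0, 1, 3]), (-1, ![3, 4, 5], ![0, 1, 2])] := by
  decide +kernel

/-! ### The model forms in terms of multi-indices -/

/-- The value of `e^{g₀} ∧ e^{g₁} ∧ e^{g₂}` on `(e_{f₀}, e_{f₁}, e_{f₂})`. -/
def deltaThree (g f : Fin 3 → Fin 7) : ℤ :=
  let d (a c : Fin 3) : ℤ := if g a = f c then 1 else 0
  d 0 0 * d 1 1 * d 2 2 - d 0 0 * d 1 2 * d 2 1 - d 0 1 * d 1 0 * d 2 2
    + d 0 1 * d 1 2 * d 2 0 + d 0 2 * d 1 0 * d 2 1 - d 0 2 * d 1 1 * d 2 0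

/-- The value of the model 3-form on `(e_{f₀}, e_{f₁}, e_{f₂})`. -/
def modelCoeff (f : Fin 3 → Fin 7) : ℤ :=
  deltaThree ![0, 1, 2] f + deltaThree ![0, 3, 4] f + deltaThree ![0, 5, 6] f
    + deltaThree ![1, 3, 5] f - deltaThree ![1, 4, 6] f - deltaThree ![2, 3, 6] f
    - deltaThree ![2, 4, 5] f

/-- The nonzero coefficients of the model 3-form. -/
def modelTable : List (ℤ × (Fin 3 → Fin 7)) :=
  [(1, ![0, 1, 2]), (1, ![0, 3, 4]), (1, ![0, 5, 6]), (1, ![1, 3, 5]), (-1, ![1, 4, 6]),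
    (-1, ![2, 3, 6]), (-1, ![2, 4, 5])]

lemma modelCoeff_support :
    ((increasingMaps 3 7).map fun I => (modelCoeff I, I)).filter (·.1 ≠ 0) = modelTable := by
  decide +kernel

/-- The value of the Hodge dual of the model 3-form on `(e_{J₀}, e_{J₁}, e_{J₂}, e_{J₃})`. -/
def starModelCoeff (J : Fin 4 → Fin 7) : ℤ :=
  (modelTable.map fun t => t.1 * signMap (n := 7) (Fin.append t.2 J)).sum

section

variable {V : Type*} [AddCommGroup V] [Module ℝ V]

lemma coframeWedge_apply_basis (b : Module.Basis (Fin 7) ℝ V) (g f : Fin 3 → Fin 7) :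
    coframeWedge b g (b ∘ f) = deltaThree g f := by
  have h : coframeWedge b g (b ∘ f) =
      Matrix.det (Matrix.of fun c a => if g a = f c then (1 : ℝ) else 0) := by
    change Matrix.det (fun c a => b.coord (g a) (b (f c))) = _
    congr 1
    funext c a
    simp [Finsupp.single_apply, eq_comm]
  rw [h, Matrix.det_fin_three]
  simp only [deltaThree, Matrix.of_apply]
  push_cast
  ring

lemma modelG2Form_apply_basis (b : Module.Basis (Fin 7) ℝ V) (f : Fin 3 → Fin 7) :
    complexify (modelG2Form b) (b ∘ f) = modelCoeff f := by
  have h : modelG2Form b (b ∘ f) = modelCoeff f := by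
    simp only [modelG2Form, AlternatingMap.sub_apply, AlternatingMap.add_apply,
      coframeWedge_apply_basis, modelCoeff]
    push_cast
    ring
  change ((modelG2Form b (b ∘ f) : ℝ) : ℂ) = _
  rw [h]
  simp

lemma hodgeStar_modelG2Form_apply_basis (b : Module.Basis (Fin 7) ℝ V) (J : Fin 4 → Fin 7) :
    hodgeStar (k := 3) (l := 4) b (complexify (modelG2Form b)) (b ∘ J) = starModelCoeff J := by
  rw [hodgeStar_apply (k := 3) (l := 4) b, sum_orderEmbedding (n := 7) fun I =>
    (signMap (n := 7) (Fin.append I J) : ℂ) * complexify (modelG2Form b) (b ∘ I)]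
  have h := sum_map_filter_coeff ((increasingMaps 3 7).map fun I => (modelCoeff I, I)) (·.1)
    (fun t => (signMap (n := 7) (Fin.append t.2 J) : ℂ))
  rw [modelCoeff_support, List.map_map] at h
  have h2 : ((starModelCoeff J : ℤ) : ℂ) =
      (modelTable.map fun t => (t.1 : ℂ) * (signMap (n := 7) (Fin.append t.2 J) : ℂ)).sum := by
    simp [starModelCoeff, modelTable]
  rw [h2, ← h]
  congr 2
  funext I
  rw [modelG2Form_apply_basis, mul_comm]
  rfl

end

/-- The seven terms of `*φ`; each index set is the complement of that of a term of `φ`. -/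
lemma starModelCoeff_support :
    ((increasingMaps 4 7).map fun J => (starModelCoeff J, J)).filter (·.1 ≠ 0) = [
      (-1, ![0, 1, 3, 6]), (-1, ![0, 1, 4, 5]), (-1, ![0, 2, 3, 5]), (1, ![0, 2, 4, 6]),
      (1, ![1, 2, 3, 4]), (1, ![1, 2, 5, 6]), (1, ![3, 4, 5, 6])] := by
  decide +kernel

/-- An increasing 6-index in seven letters is determined by the letter it omits, so a 6-form is
encoded by a vector indexed by `Fin 7`. Lexicographic order omits the last letter first. -/
lemma increasingMaps_six_seven :
    increasingMaps 6 7 = [6, 5, 4, 3, 2, 1, 0].map Fin.succAbove := by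
  decide +kernel

/-- The coefficients of `*φ ∧ E` in terms of those of `E`, for the model 3-form `φ`. -/
def starWedgeTable : Fin 7 → List (ℤ × (Fin 2 → Fin 7)) := ![
    [(1, ![5, 6]), (1, ![3, 4]), (1, ![1, 2])],
    [(1, ![4, 6]), (-1, ![3, 5]), (1, ![0, 2])],
    [(-1, ![4, 5]), (-1, ![3, 6]), (1, ![0, 1])],
    [(-1, ![2, 6]), (1, ![1, 5]), (1, ![0, 4])],
    [(1, ![2, 5]), (1, ![1, 6]), (1, ![0, 3])],
    [(1, ![2, 4]), (-1, ![1, 3]), (1, ![0, 6])],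
    [(-1, ![2, 3]), (-1, ![1, 4]), (1, ![0, 5])]]

lemma starWedgeTable_eq (i : Fin 7) :
    ((shuffles 4 2).map fun s => (s.1 * starModelCoeff (i.succAbove ∘ s.2.1),
      i.succAbove ∘ s.2.2)).filter (·.1 ≠ 0) = starWedgeTable i := by
  rw [shuffles_four_two]
  revert i
  decide +kernel

/-- The coefficients of `φ ∧ *G` in terms of those of a 4-form `G`, for the model 3-form `φ`. -/
def wedgeStarTable : Fin 7 → List (ℤ × (Fin 4 → Fin 7)) := ![
    [(1, ![0, 1, 3, 5]), (-1, ![0, 1, 4, 6]), (-1, ![0, 2, 3, 6]), (-1, ![0, 2, 4, 5])],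
    [(1, ![0, 1, 3, 4]), (1, ![0, 1, 5, 6]), (1, ![1, 2, 3, 6]), (1, ![1, 2, 4, 5])],
    [(-1, ![0, 2, 3, 4]), (-1, ![0, 2, 5, 6]), (-1, ![1, 2, 3, 5]), (1, ![1, 2, 4, 6])],
    [(1, ![0, 1, 2, 3]), (1, ![0, 3, 5, 6]), (-1, ![1, 3, 4, 6]), (-1, ![2, 3, 4, 5])],
    [(-1, ![0, 1, 2, 4]), (-1, ![0, 4, 5, 6]), (1, ![1, 3, 4, 5]), (-1, ![2, 3, 4, 6])],
    [(1, ![0, 1, 2, 5]), (1, ![0, 3, 4, 5]), (1, ![1, 4, 5, 6]), (1, ![2, 3, 5, 6])],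
    [(-1, ![0, 1, 2, 6]), (-1, ![0, 3, 4, 6]), (-1, ![1, 3, 5, 6]), (1, ![2, 4, 5, 6])]]

/-- The wedge with `φ` and the Hodge star are composed at the level of coefficients; the inner
filter removes the shuffles on which `φ` vanishes before the star is expanded. -/
lemma wedgeStarTable_eq (i : Fin 7) :
    ((((shuffles 3 3).map fun s => (s.1 * modelCoeff (i.succAbove ∘ s.2.1),
      i.succAbove ∘ s.2.2)).filter (·.1 ≠ 0)).flatMap fun t => (increasingMaps 4 7).map fun M =>
        (t.1 * signMap (n := 7) (Fin.append M t.2), M)).filter (·.1 ≠ 0) = wedgeStarTable i := by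
  rw [shuffles_three_three]
  revert i
  decide +kernel

/-! ### The terms of the identity in terms of the components of a 2-form -/

/-- The Pfaffian of a `4 × 4` submatrix; `E ∧ E` has the components `2 pfaffian`. -/
def pfaffian (c : Fin 7 → Fin 7 → ℝ) (M : Fin 4 → Fin 7) : ℝ :=
  c (M 0) (M 1) * c (M 2) (M 3) - c (M 0) (M 2) * c (M 1) (M 3) + c (M 0) (M 3) * c (M 1) (M 2)

/-- `½⟨E ∧ E, *φ⟩` for the model 3-form `φ` and a 2-form `E` with components `c`. -/
def halfPairing (c : Fin 7 → Fin 7 → ℝ) : ℝ :=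
  -pfaffian c ![0, 1, 3, 6] - pfaffian c ![0, 1, 4, 5] - pfaffian c ![0, 2, 3, 5]
  + pfaffian c ![0, 2, 4, 6] + pfaffian c ![1, 2, 3, 4] + pfaffian c ![1, 2, 5, 6]
  + pfaffian c ![3, 4, 5, 6]

/-- The components of `E ∧ *φ - E³/6`. -/
def ddtVector (c : Fin 7 → Fin 7 → ℝ) : Fin 7 → ℝ := ![
    c 5 6 + c 3 4 + c 1 2 - c 1 2 * pfaffian c ![3, 4, 5, 6] + c 1 3 * pfaffian c ![2, 4, 5, 6]
    - c 1 4 * pfaffian c ![2, 3, 5, 6] + c 1 5 * pfaffian c ![2, 3, 4, 6]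
    - c 1 6 * pfaffian c ![2, 3, 4, 5],
    c 4 6 - c 3 5 + c 0 2 - c 0 2 * pfaffian c ![3, 4, 5, 6] + c 0 3 * pfaffian c ![2, 4, 5, 6]
    - c 0 4 * pfaffian c ![2, 3, 5, 6] + c 0 5 * pfaffian c ![2, 3, 4, 6]
    - c 0 6 * pfaffian c ![2, 3, 4, 5],
    -c 4 5 - c 3 6 + c 0 1 - c 0 1 * pfaffian c ![3, 4, 5, 6] + c 0 3 * pfaffian c ![1, 4, 5, 6]
    - c 0 4 * pfaffian c ![1, 3, 5, 6] + c 0 5 * pfaffian c ![1, 3, 4, 6]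
    - c 0 6 * pfaffian c ![1, 3, 4, 5],
    -c 2 6 + c 1 5 + c 0 4 - c 0 1 * pfaffian c ![2, 4, 5, 6] + c 0 2 * pfaffian c ![1, 4, 5, 6]
    - c 0 4 * pfaffian c ![1, 2, 5, 6] + c 0 5 * pfaffian c ![1, 2, 4, 6]
    - c 0 6 * pfaffian c ![1, 2, 4, 5],
    c 2 5 + c 1 6 + c 0 3 - c 0 1 * pfaffian c ![2, 3, 5, 6] + c 0 2 * pfaffian c ![1, 3, 5, 6]
    - c 0 3 * pfaffian c ![1, 2, 5, 6] + c 0 5 * pfaffian c ![1, 2, 3, 6]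
    - c 0 6 * pfaffian c ![1, 2, 3, 5],
    c 2 4 - c 1 3 + c 0 6 - c 0 1 * pfaffian c ![2, 3, 4, 6] + c 0 2 * pfaffian c ![1, 3, 4, 6]
    - c 0 3 * pfaffian c ![1, 2, 4, 6] + c 0 4 * pfaffian c ![1, 2, 3, 6]
    - c 0 6 * pfaffian c ![1, 2, 3, 4],
    -c 2 3 - c 1 4 + c 0 5 - c 0 1 * pfaffian c ![2, 3, 4, 5] + c 0 2 * pfaffian c ![1, 3, 4, 5]
    - c 0 3 * pfaffian c ![1, 2, 4, 5] + c 0 4 * pfaffian c ![1, 2, 3, 5]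
    - c 0 5 * pfaffian c ![1, 2, 3, 4]]

/-- The components of `-½ φ ∧ *E²`. -/
def contraction (c : Fin 7 → Fin 7 → ℝ) : Fin 7 → ℝ := ![
    -pfaffian c ![0, 1, 3, 5] + pfaffian c ![0, 1, 4, 6] + pfaffian c ![0, 2, 3, 6]
    + pfaffian c ![0, 2, 4, 5],
    -pfaffian c ![0, 1, 3, 4] - pfaffian c ![0, 1, 5, 6] - pfaffian c ![1, 2, 3, 6]
    - pfaffian c ![1, 2, 4, 5],
    pfaffian c ![0, 2, 3, 4] + pfaffian c ![0, 2, 5, 6] + pfaffian c ![1, 2, 3, 5]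
    - pfaffian c ![1, 2, 4, 6],
    -pfaffian c ![0, 1, 2, 3] - pfaffian c ![0, 3, 5, 6] + pfaffian c ![1, 3, 4, 6]
    + pfaffian c ![2, 3, 4, 5],
    pfaffian c ![0, 1, 2, 4] + pfaffian c ![0, 4, 5, 6] - pfaffian c ![1, 3, 4, 5]
    + pfaffian c ![2, 3, 4, 6],
    -pfaffian c ![0, 1, 2, 5] - pfaffian c ![0, 3, 4, 5] - pfaffian c ![1, 4, 5, 6]
    - pfaffian c ![2, 3, 5, 6],
    pfaffian c ![0, 1, 2, 6] + pfaffian c ![0, 3, 4, 6] + pfaffian c ![1, 3, 5, 6]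
    - pfaffian c ![2, 4, 5, 6]]

/-! ### Evaluation of the forms on an adapted basis -/

section

variable {V : Type*} [AddCommGroup V] [Module ℝ V] (b : Module.Basis (Fin 7) ℝ V)
  {F : V [⋀^Fin 2]→ₗ[ℝ] ℂ} {c : Fin 7 → Fin 7 → ℝ}

lemma sum_orderEmbedding_six_seven {M : Type*} [AddCommMonoid M] (g : (Fin 6 → Fin 7) → M) :
    ∑ I : Fin 6 ↪o Fin 7, g I = ∑ i : Fin 7, g i.succAbove := by
  have hp : List.Perm [6, 5, 4, 3, 2, 1, 0] (List.finRange 7) := by decide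
  rw [sum_orderEmbedding g, increasingMaps_six_seven, List.map_map, Fin.sum_univ_def]
  exact (hp.map (g ∘ Fin.succAbove)).sum_eq

lemma comp_two (f : Fin 2 → Fin 7) : b ∘ f = ![b (f 0), b (f 1)] := by
  funext i; fin_cases i <;> rfl

lemma comp_four (f : Fin 4 → Fin 7) : b ∘ f = ![b (f 0), b (f 1), b (f 2), b (f 3)] := by
  funext i; fin_cases i <;> rfl

lemma comp_six (f : Fin 6 → Fin 7) :
    b ∘ f = ![b (f 0), b (f 1), b (f 2), b (f 3), b (f 4), b (f 5)] := by
  funext i; fin_cases i <;> rfl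

/-- The factor `-2` combines `i² = -1` with the fact that `E ∧ E` meets each of the three pairings
of four indices twice. -/
lemma square_apply (hF : ∀ i j, F ![b i, b j] = Complex.I * c i j) (i j k l : Fin 7) :
    wedge F F ![b i, b j, b k, b l] = ((-2 * pfaffian c ![i, j, k, l] : ℝ) : ℂ) := by
  have hI := Complex.I_sq
  rw [wedge_two_two]
  simp only [hF, pfaffian, Matrix.cons_val]
  push_cast
  linear_combination (2 * ((c i j : ℂ) * c k l - c i k * c j l + c i l * c j k)) * hI

lemma square_apply_comp (hF : ∀ i j, F ![b i, b j] = Complex.I * c i j) (M : Fin 4 → Fin 7) :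
    wedge F F (b ∘ M) = ((-2 * pfaffian c M : ℝ) : ℂ) :=
  (congrArg (wedge F F) (comp_four b M)).trans (square_apply b hF _ _ _ _)

lemma formInner_square (hF : ∀ i j, F ![b i, b j] = Complex.I * c i j) :
    formInner b (wedge F F) (hodgeStar (k := 3) (l := 4) b (complexify (modelG2Form b))) =
      ((-2 * halfPairing c : ℝ) : ℂ) := by
  have h := sum_map_filter_coeff ((increasingMaps 4 7).map fun J => (starModelCoeff J, J)) (·.1)
    (fun t => ((-2 * pfaffian c t.2 : ℝ) : ℂ))
  rw [starModelCoeff_support, List.map_map] at h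
  rw [formInner, sum_orderEmbedding (n := 7) fun J => wedge F F (b ∘ J) * starRingEnd ℂ
    (hodgeStar (k := 3) (l := 4) b (complexify (modelG2Form b)) (b ∘ J))]
  -- The components of `*φ` are integers, so the complex conjugation in the inner product has no
  -- effect.
  refine Eq.trans (congrArg List.sum (List.map_congr_left fun J _ => ?_)) (h.trans ?_)
  · rw [hodgeStar_modelG2Form_apply_basis, mul_comm, square_apply_comp b hF]
    simp
  · simp only [List.map_cons, List.map_nil, List.sum_cons, List.sum_nil, halfPairing]
    push_cast
    ring

lemma starForm_wedge_apply (hF : ∀ i j, F ![b i, b j] = Complex.I * c i j) (i : Fin 7) :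
    wedge (hodgeStar (k := 3) (l := 4) b (complexify (modelG2Form b))) F (b ∘ i.succAbove) =
      ((starWedgeTable i).map fun t => (t.1 : ℂ) * (Complex.I * c (t.2 0) (t.2 1))).sum := by
  have h := sum_map_filter_coeff ((shuffles 4 2).map fun s =>
    (s.1 * starModelCoeff (i.succAbove ∘ s.2.1), i.succAbove ∘ s.2.2)) (·.1)
    (fun t => F (b ∘ t.2))
  rw [starWedgeTable_eq, List.map_map] at h
  simp only [comp_two, hF] at h
  rw [← h, wedge_apply_shuffles (k := 4) (l := 2)]
  refine congrArg List.sum (List.map_congr_left fun s _ => ?_)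
  have h2 : F ((b ∘ i.succAbove) ∘ s.2.2) = _ := (congrArg F (comp_two b _)).trans (hF _ _)
  rw [Function.comp_assoc, hodgeStar_modelG2Form_apply_basis, h2]
  simp only [Function.comp_apply]
  push_cast
  ring

/-- Here `F³/6 = -i E³/6`, and the components of `E³/6` are the `6 × 6` Pfaffians, written by
expansion along the first row. -/
lemma cube_apply (hF : ∀ i j, F ![b i, b j] = Complex.I * c i j) (x0 x1 x2 x3 x4 x5 : Fin 7) :
    (1 / 6 : ℂ) * wedge (wedge F F) F ![b x0, b x1, b x2, b x3, b x4, b x5] =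
      -(Complex.I * (c x0 x1 * pfaffian c ![x2, x3, x4, x5] - c x0 x2 * pfaffian c ![x1, x3, x4, x5]
        + c x0 x3 * pfaffian c ![x1, x2, x4, x5] - c x0 x4 * pfaffian c ![x1, x2, x3, x5]
        + c x0 x5 * pfaffian c ![x1, x2, x3, x4] : ℝ)) := by
  rw [wedge_four_two]
  simp only [square_apply b hF, hF, pfaffian, Matrix.cons_val]
  push_cast
  ring

set_option maxRecDepth 4000 in
lemma ddtForm_apply (hF : ∀ i j, F ![b i, b j] = Complex.I * c i j) (i : Fin 7) :
    (wedge (hodgeStar (k := 3) (l := 4) b (complexify (modelG2Form b))) F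
      + (1 / 6 : ℂ) • wedge (wedge F F) F) (b ∘ i.succAbove) = Complex.I * ddtVector c i := by
  change wedge (hodgeStar (k := 3) (l := 4) b (complexify (modelG2Form b))) F (b ∘ i.succAbove) +
    (1 / 6 : ℂ) * wedge (wedge F F) F (b ∘ i.succAbove) = _
  rw [starForm_wedge_apply b hF, comp_six, cube_apply b hF]
  obtain rfl | rfl | rfl | rfl | rfl | rfl | rfl :
      i = 0 ∨ i = 1 ∨ i = 2 ∨ i = 3 ∨ i = 4 ∨ i = 5 ∨ i = 6 := by lia
  all_goals
    simp [starWedgeTable, ddtVector, Fin.succAbove, pfaffian]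
    ring

lemma formNormSq_ddtForm (hF : ∀ i j, F ![b i, b j] = Complex.I * c i j) :
    formNormSq b (wedge (hodgeStar (k := 3) (l := 4) b (complexify (modelG2Form b))) F
      + (1 / 6 : ℂ) • wedge (wedge F F) F) = ∑ i, ddtVector c i ^ 2 := by
  rw [formNormSq, sum_orderEmbedding_six_seven fun I =>
    ‖(wedge (hodgeStar (k := 3) (l := 4) b (complexify (modelG2Form b))) F
      + (1 / 6 : ℂ) • wedge (wedge F F) F) (b ∘ I)‖ ^ 2]
  refine Finset.sum_congr rfl fun i _ => ?_
  rw [ddtForm_apply b hF, norm_mul, Complex.norm_I, one_mul, Complex.norm_real, Real.norm_eq_abs,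
    sq_abs]

/-- The expression is linear in `G`, so the table of coefficients serves any 4-form; it is applied
to `F²`. -/
lemma wedge_star_apply (G : V [⋀^Fin 4]→ₗ[ℝ] ℂ) (i : Fin 7) :
    wedge (complexify (modelG2Form b)) (hodgeStar (k := 4) (l := 3) b G) (b ∘ i.succAbove) =
      ((wedgeStarTable i).map fun t => (t.1 : ℂ) * G (b ∘ t.2)).sum := by
  rw [← wedgeStarTable_eq]
  refine Eq.trans ?_ (sum_map_filter_coeff _ (fun t : ℤ × (Fin 4 → Fin 7) => t.1)
    (fun t => G (b ∘ t.2)))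
  rw [List.map_flatMap, List.flatMap_def, List.sum_flatten, List.map_map]
  have h := sum_map_filter_coeff ((shuffles 3 3).map fun s =>
    (s.1 * modelCoeff (i.succAbove ∘ s.2.1), i.succAbove ∘ s.2.2)) (·.1)
    (fun t => hodgeStar (k := 4) (l := 3) b G (b ∘ t.2))
  rw [wedge_apply_shuffles (k := 3) (l := 3)]
  refine Eq.trans (congrArg List.sum ?_) (h.trans (congrArg List.sum
    (List.map_congr_left fun t _ => ?_)))
  · rw [List.map_map]
    refine List.map_congr_left fun s _ => ?_
    rw [Function.comp_assoc, Function.comp_assoc, modelG2Form_apply_basis]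
    simp only [Function.comp_apply]
    push_cast
    ring
  · rw [hodgeStar_apply (k := 4) (l := 3) b, sum_orderEmbedding (n := 7) fun I =>
      (signMap (n := 7) (Fin.append I t.2) : ℂ) * G (b ∘ I), ← List.sum_map_mul_left,
      Function.comp_apply, List.map_map]
    refine congrArg List.sum (List.map_congr_left fun M _ => ?_)
    simp only [Function.comp_apply]
    push_cast
    ring

/-- The components of `φ ∧ *F²` are `2 * contraction c i`, whence the factor 4, which cancels the
`¼` of the identity. -/
lemma formNormSq_wedge_star (hF : ∀ i j, F ![b i, b j] = Complex.I * c i j) :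
    formNormSq b (wedge (complexify (modelG2Form b))
      (hodgeStar (k := 4) (l := 3) b (wedge F F))) = 4 * ∑ i, contraction c i ^ 2 := by
  rw [formNormSq, sum_orderEmbedding_six_seven fun I => ‖wedge (complexify (modelG2Form b))
      (hodgeStar (k := 4) (l := 3) b (wedge F F)) (b ∘ I)‖ ^ 2, Finset.mul_sum]
  refine Finset.sum_congr rfl fun i _ => ?_
  have h : ((wedgeStarTable i).map fun t => (t.1 : ℂ) * wedge F F (b ∘ t.2)).sum =
      ((2 * contraction c i : ℝ) : ℂ) := by
    have h0 : ((wedgeStarTable i).map fun t => (t.1 : ℂ) * wedge F F (b ∘ t.2)) =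
        (wedgeStarTable i).map fun t => (t.1 : ℂ) * ((-2 * pfaffian c t.2 : ℝ) : ℂ) :=
      List.map_congr_left fun t _ => by rw [square_apply_comp b hF]
    rw [h0]
    fin_cases i <;> simp [wedgeStarTable, contraction, pfaffian] <;> ring
  rw [wedge_star_apply, h, Complex.norm_real, Real.norm_eq_abs, sq_abs]
  ring

/-- The matrix is transposed because `E^♯ e_j = ∑ E(e_j, e_k) e_k` fills the `j`-th column. -/
lemma det_sharpEnd {E : V [⋀^Fin 2]→ₗ[ℝ] ℝ} (hE : ∀ i j, E ![b i, b j] = c i j) :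
    LinearMap.det (LinearMap.id + sharpEnd b E) = Matrix.det (1 + Matrix.of fun i j => c j i) := by
  rw [← LinearMap.det_toMatrix b, map_add, LinearMap.toMatrix_id]
  congr 2
  ext i j
  have h : sharpEnd b E (b j) = ∑ k, E ![b j, b k] • b k := rfl
  rw [LinearMap.toMatrix_apply, h]
  simp [hE, Finsupp.single_apply]

end

/-! ### The determinant of `1 + E` for skew-symmetric `E` -/

set_option maxHeartbeats 0 in
set_option maxRecDepth 100000 in
/-- `det (1 + E)` is the sum of the squares of the Pfaffians of the principal submatrices of `E`. -/
lemma det_one_add_skew (a01 a02 a03 a04 a05 a06 a12 a13 a14 a15 a16 a23 a24 a25 a26 a34 a35 a36 a45 a46 a56 : ℝ) : Matrix.det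
    !![1, a01, a02, a03, a04, a05, a06;
    -a01, 1, a12, a13, a14, a15, a16;
    -a02, -a12, 1, a23, a24, a25, a26;
    -a03, -a13, -a23, 1, a34, a35, a36;
    -a04, -a14, -a24, -a34, 1, a45, a46;
    -a05, -a15, -a25, -a35, -a45, 1, a56;
    -a06, -a16, -a26, -a36, -a46, -a56, 1] =
      1 + a01 ^ 2 + a02 ^ 2 + a03 ^ 2 + a04 ^ 2 + a05 ^ 2 + a06 ^ 2 + a12 ^ 2 + a13 ^ 2
      + a14 ^ 2 + a15 ^ 2 + a16 ^ 2 + a23 ^ 2 + a24 ^ 2 + a25 ^ 2 + a26 ^ 2 + a34 ^ 2 + a35 ^ 2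
      + a36 ^ 2 + a45 ^ 2 + a46 ^ 2 + a56 ^ 2 + (a01 * a23 - a02 * a13 + a03 * a12) ^ 2
      + (a01 * a24 - a02 * a14 + a04 * a12) ^ 2 + (a01 * a25 - a02 * a15 + a05 * a12) ^ 2
      + (a01 * a26 - a02 * a16 + a06 * a12) ^ 2 + (a01 * a34 - a03 * a14 + a04 * a13) ^ 2
      + (a01 * a35 - a03 * a15 + a05 * a13) ^ 2 + (a01 * a36 - a03 * a16 + a06 * a13) ^ 2
      + (a01 * a45 - a04 * a15 + a05 * a14) ^ 2 + (a01 * a46 - a04 * a16 + a06 * a14) ^ 2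
      + (a01 * a56 - a05 * a16 + a06 * a15) ^ 2 + (a02 * a34 - a03 * a24 + a04 * a23) ^ 2
      + (a02 * a35 - a03 * a25 + a05 * a23) ^ 2 + (a02 * a36 - a03 * a26 + a06 * a23) ^ 2
      + (a02 * a45 - a04 * a25 + a05 * a24) ^ 2 + (a02 * a46 - a04 * a26 + a06 * a24) ^ 2
      + (a02 * a56 - a05 * a26 + a06 * a25) ^ 2 + (a03 * a45 - a04 * a35 + a05 * a34) ^ 2
      + (a03 * a46 - a04 * a36 + a06 * a34) ^ 2 + (a03 * a56 - a05 * a36 + a06 * a35) ^ 2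
      + (a04 * a56 - a05 * a46 + a06 * a45) ^ 2 + (a12 * a34 - a13 * a24 + a14 * a23) ^ 2
      + (a12 * a35 - a13 * a25 + a15 * a23) ^ 2 + (a12 * a36 - a13 * a26 + a16 * a23) ^ 2
      + (a12 * a45 - a14 * a25 + a15 * a24) ^ 2 + (a12 * a46 - a14 * a26 + a16 * a24) ^ 2
      + (a12 * a56 - a15 * a26 + a16 * a25) ^ 2 + (a13 * a45 - a14 * a35 + a15 * a34) ^ 2
      + (a13 * a46 - a14 * a36 + a16 * a34) ^ 2 + (a13 * a56 - a15 * a36 + a16 * a35) ^ 2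
      + (a14 * a56 - a15 * a46 + a16 * a45) ^ 2 + (a23 * a45 - a24 * a35 + a25 * a34) ^ 2
      + (a23 * a46 - a24 * a36 + a26 * a34) ^ 2 + (a23 * a56 - a25 * a36 + a26 * a35) ^ 2
      + (a24 * a56 - a25 * a46 + a26 * a45) ^ 2 + (a34 * a56 - a35 * a46 + a36 * a45) ^ 2
      + (a01 * (a23 * a45 - a24 * a35 + a25 * a34) - a02 * (a13 * a45 - a14 * a35 + a15 * a34)
      + a03 * (a12 * a45 - a14 * a25 + a15 * a24) - a04 * (a12 * a35 - a13 * a25 + a15 * a23)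
      + a05 * (a12 * a34 - a13 * a24 + a14 * a23)) ^ 2
      + (a01 * (a23 * a46 - a24 * a36 + a26 * a34) - a02 * (a13 * a46 - a14 * a36 + a16 * a34)
      + a03 * (a12 * a46 - a14 * a26 + a16 * a24) - a04 * (a12 * a36 - a13 * a26 + a16 * a23)
      + a06 * (a12 * a34 - a13 * a24 + a14 * a23)) ^ 2
      + (a01 * (a23 * a56 - a25 * a36 + a26 * a35) - a02 * (a13 * a56 - a15 * a36 + a16 * a35)
      + a03 * (a12 * a56 - a15 * a26 + a16 * a25) - a05 * (a12 * a36 - a13 * a26 + a16 * a23)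
      + a06 * (a12 * a35 - a13 * a25 + a15 * a23)) ^ 2
      + (a01 * (a24 * a56 - a25 * a46 + a26 * a45) - a02 * (a14 * a56 - a15 * a46 + a16 * a45)
      + a04 * (a12 * a56 - a15 * a26 + a16 * a25) - a05 * (a12 * a46 - a14 * a26 + a16 * a24)
      + a06 * (a12 * a45 - a14 * a25 + a15 * a24)) ^ 2
      + (a01 * (a34 * a56 - a35 * a46 + a36 * a45) - a03 * (a14 * a56 - a15 * a46 + a16 * a45)
      + a04 * (a13 * a56 - a15 * a36 + a16 * a35) - a05 * (a13 * a46 - a14 * a36 + a16 * a34)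
      + a06 * (a13 * a45 - a14 * a35 + a15 * a34)) ^ 2
      + (a02 * (a34 * a56 - a35 * a46 + a36 * a45) - a03 * (a24 * a56 - a25 * a46 + a26 * a45)
      + a04 * (a23 * a56 - a25 * a36 + a26 * a35) - a05 * (a23 * a46 - a24 * a36 + a26 * a34)
      + a06 * (a23 * a45 - a24 * a35 + a25 * a34)) ^ 2
      + (a12 * (a34 * a56 - a35 * a46 + a36 * a45) - a13 * (a24 * a56 - a25 * a46 + a26 * a45)
      + a14 * (a23 * a56 - a25 * a36 + a26 * a35) - a15 * (a23 * a46 - a24 * a36 + a26 * a34)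
      + a16 * (a23 * a45 - a24 * a35 + a25 * a34)) ^ 2 := by
  simp [Matrix.det_succ_row_zero, Fin.sum_univ_succ, Fin.succAbove]
  ring

-- The whole pointwise identity in coordinates. Skewness reduces the matrix to its 21 entries above
-- the diagonal, after which both sides are explicit polynomials in them.
set_option maxHeartbeats 0 in
set_option maxRecDepth 100000 in
lemma model_identity {c : Fin 7 → Fin 7 → ℝ} (hc : ∀ i j, c j i = -c i j) :
    (1 - halfPairing c) ^ 2 + ∑ i, ddtVector c i ^ 2 + ∑ i, contraction c i ^ 2 =
      Matrix.det (1 + Matrix.of fun i j => c j i) := by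
  have hd (i : Fin 7) : c i i = 0 := by linarith [hc i i]
  have h : (1 + Matrix.of fun i j => c j i).transpose = !![1, c 0 1, c 0 2, c 0 3, c 0 4, c 0 5, c 0 6;
      -c 0 1, 1, c 1 2, c 1 3, c 1 4, c 1 5, c 1 6;
      -c 0 2, -c 1 2, 1, c 2 3, c 2 4, c 2 5, c 2 6;
      -c 0 3, -c 1 3, -c 2 3, 1, c 3 4, c 3 5, c 3 6;
      -c 0 4, -c 1 4, -c 2 4, -c 3 4, 1, c 4 5, c 4 6;
      -c 0 5, -c 1 5, -c 2 5, -c 3 5, -c 4 5, 1, c 5 6;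
      -c 0 6, -c 1 6, -c 2 6, -c 3 6, -c 4 6, -c 5 6, 1] := by
    have hM (i j : Fin 7) :
        (1 + Matrix.of fun i j => c j i : Matrix (Fin 7) (Fin 7) ℝ).transpose i j =
          if i = j then 1 else c i j := by
      by_cases hij : i = j <;> simp [hij, hd, eq_comm]
    ext i j
    rw [hM]
    fin_cases i <;> fin_cases j
    all_goals first | rfl | exact hc _ _
  rw [← Matrix.det_transpose, h, det_one_add_skew]
  simp only [Fin.sum_univ_succ, Fin.sum_univ_zero, ddtVector, contraction, halfPairing, pfaffian]
  simp
  ring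

/-- The signs `(-1)^(i + j)` turn components on the complement of an index into those of the Hodge
dual vector, so the right side is `E` applied to the dual of `E ∧ *φ - E³/6`. The cubic part drops
out: the signed `6 × 6` sub-Pfaffians of a skew `7 × 7` matrix form a vector in its kernel. Only the
contribution of `E ∧ *φ` remains, which is quadratic in `E`. -/
lemma contraction_eq {c : Fin 7 → Fin 7 → ℝ} (hc : ∀ i j, c j i = -c i j) (i : Fin 7) :
    contraction c i = -∑ j : Fin 7, (-1) ^ (i + j : ℕ) * c i j * ddtVector c j := by
  have hd (i : Fin 7) : c i i = 0 := by linarith [hc i i]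
  simp only [Fin.sum_univ_succ, Fin.sum_univ_zero, ddtVector]
  fin_cases i <;> simp [contraction, pfaffian, hd, hc 0 1, hc 0 2, hc 0 3, hc 0 4, hc 0 5, hc 0 6, hc 1 2, hc 1 3, hc 1 4, hc 1 5, hc 1 6, hc 2 3, hc 2 4, hc 2 5, hc 2 6, hc 3 4, hc 3 5, hc 3 6, hc 4 5, hc 4 6, hc 5 6] <;> ring

/-! ### The identity at a point -/

section

variable {V : Type*} [AddCommGroup V] [Module ℝ V]

-- Forms of even degree commute. This reconciles `F ∧ *φ` in the dDT equation with `*φ ∧ F` in the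
-- identity.
set_option maxRecDepth 10000 in
lemma wedge_comm_two_four (α : V [⋀^Fin 2]→ₗ[ℝ] ℂ) (β : V [⋀^Fin 4]→ₗ[ℝ] ℂ) :
    wedge α β = wedge β α := by
  ext v
  have hv : v = ![v 0, v 1, v 2, v 3, v 4, v 5] := by
    funext i; fin_cases i <;> rfl
  rw [hv]
  have h1 := wedge_two_four α β (v 0) (v 1) (v 2) (v 3) (v 4) (v 5)
  have h2 := wedge_four_two β α (v 0) (v 1) (v 2) (v 3) (v 4) (v 5)
  refine h1.trans (Eq.trans ?_ h2.symm)
  ring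

variable (b : Module.Basis (Fin 7) ℝ V) {F : V [⋀^Fin 2]→ₗ[ℝ] ℂ}

/-- The components of the real 2-form `-iF`. -/
def components (F : V [⋀^Fin 2]→ₗ[ℝ] ℂ) (i j : Fin 7) : ℝ :=
  realPart ((-Complex.I) • F) ![b i, b j]

lemma apply_eq_components (hF : ∀ w, (F w).re = 0) (i j : Fin 7) :
    F ![b i, b j] = Complex.I * components b F i j := by
  apply Complex.ext <;> simp [components, realPart, hF]

lemma components_swap (i j : Fin 7) : components b F j i = -components b F i j := by
  have h := (realPart ((-Complex.I) • F)).map_swap ![b i, b j] (zero_ne_one (α := Fin 2))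
  rw [components, components, ← h]
  congr 1
  funext k
  fin_cases k <;> simp

lemma pointwise_identity (hF : ∀ w, (F w).re = 0) :
    (1 - halfPairing (components b F)) ^ 2
      + formNormSq b (wedge (hodgeStar (k := 3) (l := 4) b (complexify (modelG2Form b))) F
        + (1 / 6 : ℂ) • wedge (wedge F F) F)
      + 1 / 4 * formNormSq b (wedge (complexify (modelG2Form b))
        (hodgeStar (k := 4) (l := 3) b (wedge F F)))
      = LinearMap.det (LinearMap.id + sharpEnd b (realPart ((-Complex.I) • F))) := by
  rw [formNormSq_ddtForm b (apply_eq_components b hF),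
    formNormSq_wedge_star b (apply_eq_components b hF), det_sharpEnd b fun _ _ => rfl,
    ← model_identity (c := fun i j => realPart ((-Complex.I) • F) ![b i, b j])
      fun i j => components_swap b i j]
  change _ = (1 - halfPairing (components b F)) ^ 2 + ∑ i, ddtVector (components b F) i ^ 2
    + ∑ i, contraction (components b F) i ^ 2
  ring

/-- If `*φ ∧ F + F³/6 = 0`, then `φ ∧ *F² = 0`. -/
lemma wedge_star_eq_zero (hF : ∀ w, (F w).re = 0)
    (h : wedge (hodgeStar (k := 3) (l := 4) b (complexify (modelG2Form b))) F
        + (1 / 6 : ℂ) • wedge (wedge F F) F = 0) :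
    formNormSq b (wedge (complexify (modelG2Form b))
        (hodgeStar (k := 4) (l := 3) b (wedge F F))) = 0 := by
  have hc := apply_eq_components b hF
  rw [← formNormSq_eq_zero b, formNormSq_ddtForm b hc,
    Finset.sum_eq_zero_iff_of_nonneg fun _ _ => sq_nonneg _] at h
  have h0 (i : Fin 7) : ddtVector (components b F) i = 0 :=
    pow_eq_zero_iff two_ne_zero |>.1 (h i (Finset.mem_univ i))
  rw [formNormSq_wedge_star b hc]
  simp [contraction_eq fun i j => components_swap b i j, h0]

lemma formNormSq_nonneg {n k : ℕ} (b : Module.Basis (Fin n) ℝ V) (α : V [⋀^Fin k]→ₗ[ℝ] ℂ) :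
    0 ≤ formNormSq b α :=
  Finset.sum_nonneg fun _ _ => by positivity

/-- The star on the manifold reindexes the basis along `k + l = 7`; for numerals this is an equation
`7 = 7`, and the reindexing disappears. -/
lemma reindex_finCongr {n : ℕ} (h : n = n) (b : Module.Basis (Fin n) ℝ V) :
    b.reindex (finCongr h) = b := by
  ext i
  simp

end

end G2dDT

end

/-! ### The theorem on the manifold -/

open G2dDT
set_option maxRecDepth 10000 in
theorem theorem5p1
    -- an oriented smooth 7-manifold with a G₂-structure
    {X : Type*} [TopologicalSpace X] [T2Space X] [SecondCountableTopology X]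
    [ChartedSpace (EuclideanSpace ℝ (Fin 7)) X] [IsManifold (𝓡 7) ∞ X]
    (o : ManifoldOrientation X) (φ : G2Structure o)
    -- a smooth complex line bundle with a Hermitian metric
    {L : X → Type*} [∀ x, NormedAddCommGroup (L x)] [∀ x, InnerProductSpace ℂ (L x)]
    [TopologicalSpace (TotalSpace ℂ L)] [FiberBundle ℂ L] [VectorBundle ℂ ℂ L]
    [VectorBundle ℝ ℂ L] [ContMDiffVectorBundle ∞ ℂ L (𝓡 7)] [IsSmoothHermitian L]
    -- a Hermitian connection
    (D : HermitianConnection L) :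
    (∀ p : X,
      (1 + 1 / 2 * φ.inner p (D.curvatureSq p) (φ.starForm p)) ^ 2
        + φ.normSq p (wedge (φ.starForm p) (D.curvature p) + (1 / 6 : ℂ) • D.curvatureCube p)
        + 1 / 4 * φ.normSq p (wedge (φ.formC p)
            (φ.star p (k := 4) (l := 3) rfl (D.curvatureSq p)))
      = ((LinearMap.det (LinearMap.id + φ.sharp p ((-Complex.I) • D.curvature p)) : ℝ) : ℂ)) ∧
    (∀ p : X,
      ‖1 + 1 / 2 * φ.inner p (D.curvatureSq p) (φ.starForm p)‖
        ≤ √(LinearMap.det (LinearMap.id + φ.sharp p ((-Complex.I) • D.curvature p)))) ∧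
    ((∀ p : X,
      ‖1 + 1 / 2 * φ.inner p (D.curvatureSq p) (φ.starForm p)‖
        = √(LinearMap.det (LinearMap.id + φ.sharp p ((-Complex.I) • D.curvature p)))) ↔
      D.IsG2dDT φ) := by
  have hstar (p : X) : φ.starForm p = hodgeStar (k := 3) (l := 4) (φ.adaptedBasis p)
      (complexify (modelG2Form (φ.adaptedBasis p))) := by
    rw [G2Structure.starForm, G2Structure.star, G2Structure.formC, (φ.adaptedBasis_spec p).2]
    exact congrArg (hodgeStar (k := 3) (l := 4) · _) (reindex_finCongr (n := 7) rfl _)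
  have hstar' (p : X) (G : TangentSpace (𝓡 7) p [⋀^Fin 4]→ₗ[ℝ] ℂ) :
      φ.star p (k := 4) (l := 3) rfl G = hodgeStar (k := 4) (l := 3) (φ.adaptedBasis p) G :=
    congrArg (hodgeStar (k := 4) (l := 3) · _) (reindex_finCongr (n := 7) rfl _)
  have hform (p : X) : φ.formC p = complexify (modelG2Form (φ.adaptedBasis p)) := by
    rw [G2Structure.formC, (φ.adaptedBasis_spec p).2]
  have hF (p : X) := D.curvature_re p
  set r : X → ℝ := fun p => 1 - halfPairing (components (φ.adaptedBasis p) (D.curvature p)) with hr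
  -- The inner product is a priori complex; it is identified with a real number, so that its square
  -- and its norm are those of `r p`.
  have hinner (p : X) : 1 + 1 / 2 * φ.inner p (D.curvatureSq p) (φ.starForm p) = (r p : ℂ) := by
    have h := formInner_square (φ.adaptedBasis p) (apply_eq_components (φ.adaptedBasis p) (hF p))
    rw [hstar]
    refine (congrArg (fun z : ℂ => 1 + 1 / 2 * z) h).trans ?_
    simp only [hr]
    push_cast
    ring
  set A : X → ℝ := fun p => φ.normSq p
    (wedge (φ.starForm p) (D.curvature p) + (1 / 6 : ℂ) • D.curvatureCube p) with hA
  set B : X → ℝ := fun p => φ.normSq p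
    (wedge (φ.formC p) (φ.star p (k := 4) (l := 3) rfl (D.curvatureSq p))) with hB
  set d : X → ℝ := fun p =>
    LinearMap.det (LinearMap.id + φ.sharp p ((-Complex.I) • D.curvature p)) with hd
  have key (p : X) : r p ^ 2 + A p + 1 / 4 * B p = d p := by
    simp only [hA, hB, hstar, hstar', hform]
    exact pointwise_identity (φ.adaptedBasis p) (hF p)
  have hA0 (p : X) : 0 ≤ A p := formNormSq_nonneg _ _
  have hB0 (p : X) : 0 ≤ B p := formNormSq_nonneg _ _
  have hdDT : D.IsG2dDT φ ↔ ∀ p, A p = 0 := by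
    refine forall_congr' fun p => ?_
    rw [wedge_comm_two_four, add_comm]
    exact (formNormSq_eq_zero _).symm
  have hAB (p : X) (h : A p = 0) : B p = 0 := by
    simp only [hA, hB, hstar, hstar', hform] at h ⊢
    exact wedge_star_eq_zero (φ.adaptedBasis p) (hF p) ((formNormSq_eq_zero _).1 h)
  have hsqrt (p : X) : √(r p ^ 2) = |r p| := Real.sqrt_sq_eq_abs _
  simp only [hinner, Complex.norm_real, Real.norm_eq_abs]
  refine ⟨fun p => ?_, fun p => ?_, ?_⟩
  · change _ + ((A p : ℝ) : ℂ) + 1 / 4 * ((B p : ℝ) : ℂ) = ((d p : ℝ) : ℂ)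
    rw [← key p]
    push_cast
    ring
  · rw [← hsqrt]
    exact Real.sqrt_le_sqrt (by linarith [key p, hA0 p, hB0 p])
  · rw [hdDT]
    refine forall_congr' fun p => ?_
    have hd0 : 0 ≤ d p := by linarith [key p, hA0 p, hB0 p, sq_nonneg (r p)]
    -- Equality at `p` now reads `r p ^ 2 = d p`, that is `A p + ¼ B p = 0` by `key`.
    rw [← hsqrt, Real.sqrt_inj (sq_nonneg _) hd0]
    refine ⟨fun h => ?_, fun h => ?_⟩
    -- Two nonnegative terms with sum zero both vanish.
    · linarith [key p, hA0 p, hB0 p]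
    -- Here the vanishing of `B p` is not automatic; it follows from the dDT equation through `hAB`.
    · linarith [key p, hAB p h]
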